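/- Let $\mathbb D=\{z\in\mathbb C:|z|<1\}$ and let $\mathcal A$ be the set of analytic $f:\mathbb D\to\mathbb C$ with $f(0)=0$, $f'(0)=1$. For $\psi$ on $\mathbb D$ let $\mathcal S^*_c(\psi)$ be the set of $f\in\mathcal A$ such that $$\frac{2zf'(z)}{f(z)+\overline{f(\bar z)}}=\psi(\omega(z))\qquad(z\in\mathbb D)$$ for some analytic $\omega:\mathbb D\to\mathbb D$ with $\omega(0)=0$ and $|\omega(z)|\le|z|$; here the denominator does not vanish for $z\ne0$, and the quotient has its limit value $1$ at $z=0$. For analytic $f,g$ in $\mathbb D$ write $g\ll f$ ($g$ is majorized by $f$) if $g=\Phi f$ in $\mathbb D$ for some analytic $\Phi$ in $\mathbb D$ with $|\Phi|\le1$. All powers and roots are principal. In each of the cases (i)–(ix) below, the equation $q(r)=0$ has a smallest root $r_\psi$ in $(0,1)$, and whenever $f\in\mathcal S^*_c(\psi)$, $g$ is analytic in $\mathbb D$ and $g\ll f$, we have $$|g'(z)|\le|f'(z)|\qquad\text{for }|z|\le r_\psi .$$ The radius $r_\psi$ is sharp (in case (v) under the normalization $\psi(0)=1$, i.e. $b=1$;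 for $b\neq1$ the class is empty): for every $r\in(r_\psi,1)$ there are $f\in\mathcal S^*_c(\psi)$, an analytic $g\ll f$ and a point $z$ with $|z|=r$ such that $|g'(z)|>|f'(z)|$. - (i) $\psi(z)=\frac{1+Dz}{1+Ez}$, $-1\le E<D\le1$: $q(r)=(1-r^2)\frac{1-Dr}{1-Er}-2r$. - (ii) $\psi(z)=\frac{1+(1-2\alpha)z}{1-z}$, $0\le\alpha<1$: $q(r)=(1-r)(1-(1-2\alpha)r)-2r$. - (iii) $\psi(z)=\left(\frac{1+z}{1-z}\right)^{\eta}$, $0<\eta\le1$: $q(r)=(1-r^2)\left(\frac{1-r}{1+r}\right)^{\eta}-2r$. - (iv) $\psi(z)=\sqrt2-(\sqrt2-1)\sqrt{\frac{1-z}{1+2(\sqrt2-1)z}}$: $q(r)=(1-r^2)\left(\sqrt2-(\sqrt2-1)\sqrt{\frac{1+r}{1-2(\sqrt2-1)r}}\right)-2r$. - (v) $\psi(z)=(b(1+z))^{1/a}$, $a\ge1$, $b\ge\frac12$: $q(r)=(1-r^2)(b(1-r))^{1/a}-2r$. - (vi) $\psi(z)=e^z$: $q(r)=(1-r^2)-2re^r$.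 - (vii) $\psi(z)=z+\sqrt{1+z^2}$: $q(r)=(1-r^2)(\sqrt{1+r^2}-r)-2r$. - (viii) $\psi(z)=\frac{2}{1+e^{-z}}$: $q(r)=(1-r^2)-r(1+e^r)$. - (ix) $\psi(z)=1+\sin z$: $q(r)=(1-r^2)(1-\sin r)-2r$. -/

import Mathlib

namespace ConjStarlike

/-- The open unit disc. -/
abbrev disc : Set ℂ := Metric.ball (0 : ℂ) 1

/-- The class of normalized analytic functions in the unit disc: `f(0) = 0`, `f'(0) = 1`. -/
def classA : Set (ℂ → ℂ) :=
  {f | DifferentiableOn ℂ f disc ∧ f 0 = 0 ∧ deriv f 0 = 1}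

/-- `F ≺ G` in the unit disc: `F = G ∘ ω` with `ω` analytic, `ω(0) = 0`, `|ω(z)| ≤ |z|`. -/
def Subordinate (F G : ℂ → ℂ) : Prop :=
  ∃ ω : ℂ → ℂ, DifferentiableOn ℂ ω disc ∧ ω 0 = 0 ∧
    (∀ z ∈ disc, ‖ω z‖ ≤ ‖z‖) ∧ ∀ z ∈ disc, F z = G (ω z)

/-- `f(z) + conj (f (conj z))`. -/
def conjSum (f : ℂ → ℂ) (z : ℂ) : ℂ :=
  f z + (starRingEnd ℂ) (f ((starRingEnd ℂ) z))

/-- The quotient `2 z f'(z) / (f(z) + conj (f (conj z)))`; its singularity at the origin is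
removable for normalized `f`, and it is given its limit `1` there. -/
noncomputable def conjQuotient (f : ℂ → ℂ) (z : ℂ) : ℂ :=
  if z = 0 then 1 else 2 * z * deriv f z / conjSum f z

/-- The class of functions starlike with respect to conjugate points associated with `ψ`. The
second clause says that the quotient is well defined away from the origin. -/
def starlikeConj (ψ : ℂ → ℂ) : Set (ℂ → ℂ) :=
  {f | f ∈ classA ∧ (∀ z ∈ disc, z ≠ 0 → conjSum f z ≠ 0) ∧ Subordinate (conjQuotient f) ψ}

/-- `g` is majorized by `f` in the unit disc. -/
def Majorized (g f : ℂ → ℂ) : Prop :=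
  ∃ Φ : ℂ → ℂ, DifferentiableOn ℂ Φ disc ∧ (∀ z ∈ disc, ‖Φ z‖ ≤ 1) ∧
    ∀ z ∈ disc, g z = Φ z * f z

/-- `ρ` is the smallest root of `q` in the interval `(0, 1)`. -/
def IsSmallestRoot (q : ℝ → ℝ) (ρ : ℝ) : Prop :=
  IsLeast {r : ℝ | r ∈ Set.Ioo 0 1 ∧ q r = 0} ρ

/-- If `f` is in the class and `g` is analytic in the disc and majorized by `f`, then
`|g'| ≤ |f'|` in `|z| ≤ ρ`. -/
def MajorizesDerivUpTo (S : Set (ℂ → ℂ)) (ρ : ℝ) : Prop :=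
  ∀ f ∈ S, ∀ g : ℂ → ℂ, DifferentiableOn ℂ g disc → Majorized g f →
    ∀ z : ℂ, ‖z‖ ≤ ρ → ‖deriv g z‖ ≤ ‖deriv f z‖

/-- The radius `ρ` is sharp: on each circle of radius `r ∈ (ρ, 1)` the inequality `|g'| ≤ |f'|`
fails for some admissible pair. In particular `ρ` cannot be replaced by a larger number. -/
def IsSharpRadius (S : Set (ℂ → ℂ)) (ρ : ℝ) : Prop :=
  ∀ r : ℝ, ρ < r → r < 1 →
    ∃ f ∈ S, ∃ g : ℂ → ℂ, DifferentiableOn ℂ g disc ∧ Majorized g f ∧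
      ∃ z : ℂ, ‖z‖ = r ∧ ‖deriv f z‖ < ‖deriv g z‖

/-- The smallest root in `(0, 1)` of `q` exists and is the sharp majorization radius for the
class associated with `ψ`. -/
def SharpMajorization (ψ : ℂ → ℂ) (q : ℝ → ℝ) : Prop :=
  ∃ ρ : ℝ, IsSmallestRoot q ρ ∧ MajorizesDerivUpTo (starlikeConj ψ) ρ ∧
    IsSharpRadius (starlikeConj ψ) ρ

/-- The Janowski function. -/
noncomputable def psiJanowski (D E : ℝ) (z : ℂ) : ℂ := (1 + D * z) / (1 + E * z)

/-- The function associated with starlikeness of order `α`. -/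
noncomputable def psiOrder (α : ℝ) (z : ℂ) : ℂ := (1 + (1 - 2 * α) * z) / (1 - z)

/-- The function associated with strong starlikeness of order `η` (principal power). -/
noncomputable def psiStrong (η : ℝ) (z : ℂ) : ℂ := ((1 + z) / (1 - z)) ^ (η : ℂ)

/-- `√2 - (√2 - 1) √((1 - z) / (1 + 2 (√2 - 1) z))` (principal square root). -/
noncomputable def psiRL (z : ℂ) : ℂ :=
  (√2 : ℝ) - ((√2 : ℝ) - 1) * ((1 - z) / (1 + 2 * ((√2 : ℝ) - 1) * z)) ^ (1 / 2 : ℂ)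

/-- `(b (1 + z)) ^ (1 / a)` (principal power). -/
noncomputable def psiPower (a b : ℝ) (z : ℂ) : ℂ := (b * (1 + z)) ^ (1 / a : ℂ)

/-- `z + √(1 + z²)` (principal square root). -/
noncomputable def psiCrescent (z : ℂ) : ℂ := z + (1 + z ^ 2) ^ (1 / 2 : ℂ)

/-- The modified sigmoid `2 / (1 + e^{-z})`. -/
noncomputable def psiSigmoid (z : ℂ) : ℂ := 2 / (1 + Complex.exp (-z))

end ConjStarlike

namespace ConjStarlike

open Complex Metric Set
open scoped ComplexConjugate

/-! Let h be half of `conjSum f` and write h(z) = z k(z). Membership in the class gives f' = k ·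
ψ(ω), and adding the conjugate of this identity at z̄ expresses Re(1 + zk'/k) as the mean of Re
ψ(ω(z)) and Re ψ(ω(z̄)). Both are at least m(|z|), where m(s) = ψ(-s) is the minimum of Re ψ on |w|
≤ s. If g = Φf, Schwarz–Pick for Φ yields |g'| ≤ |f'| wherever 2|f| ≤ (1 - |z|²)|f'|. Hence it
suffices to prove m(|z|)|f(z)| ≤ |z||f'(z)| up to the root of (1 - r²)m(r) = 2r, which is at most √2
- 1 when m(0) = 1.

The difficulty is that f need not equal h, so zf'/f is not ψ(ω). In `mul_norm_le_norm_mul_deriv`, f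
is integrated along the ray to z and compared with the barrier Γ·s|k|, where s is the modulus and Γ
= 1 + β(s)(|ψ(ω)|/m(s) - 1) with 0 ≤ β ≤ 1. The derivative of the barrier contains zω', which
Dieudonné's inequality places near ω. The comparison thus becomes a pointwise inequality in w = ω(z)
and ζ = zω'(z) - ω(z).

With β ≡ 1 this inequality follows from Re(zω'ψ'(ω)/ψ(ω)) ≥ s m'(s)/m(s). Since |zω'| ≤ |z| for |z|
≤ √2 - 1, the bound |ψ'/ψ| ≤ -m'/m is then enough. It serves every ψ except two: `psiCrescent` needs
the real part itself, and the Janowski functions need a nonconstant β.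

For sharpness, f(z) = z exp ∫(ψ - 1)/t is symmetric with ω the identity, and a disc automorphism Φ
that is extremal for Schwarz–Pick at -r makes |g'| exceed |f'| there. -/

theorem mem_disc {z : ℂ} : z ∈ disc ↔ ‖z‖ < 1 := by simp [disc]

theorem conj_mem_disc {u : ℂ} (hu : u ∈ disc) : conj u ∈ disc := by
  rw [mem_disc, Complex.norm_conj]
  exact mem_disc.mp hu

/-! ### Möbius maps and the Schwarz–Pick and Dieudonné inequalities -/

theorem one_sub_conj_mul_ne_zero {a b : ℂ} (ha : ‖a‖ < 1) (hb : ‖b‖ ≤ 1) : 1 - conj a * b ≠ 0 := by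
  intro h
  have h1 : conj a * b = 1 := (sub_eq_zero.mp h).symm
  have h2 : ‖a‖ * ‖b‖ = 1 := by
    rw [← Complex.norm_conj a, ← norm_mul, h1, norm_one]
  nlinarith [norm_nonneg a, norm_nonneg b]

theorem norm_moebius_lt_one {a b : ℂ} (ha : ‖a‖ < 1) (hb : ‖b‖ < 1) :
    ‖(b - a) / (1 - conj a * b)‖ < 1 := by
  have h0 := one_sub_conj_mul_ne_zero ha hb.le
  rw [norm_div, div_lt_one (norm_pos_iff.mpr h0)]
  apply lt_of_pow_lt_pow_left₀ 2 (norm_nonneg _)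
  have e : ‖1 - conj a * b‖ ^ 2 - ‖b - a‖ ^ 2 = (1 - ‖a‖ ^ 2) * (1 - ‖b‖ ^ 2) := by
    simp only [Complex.sq_norm, Complex.normSq_apply]
    simp
    ring
  have : 0 < (1 - ‖a‖ ^ 2) * (1 - ‖b‖ ^ 2) := by
    apply mul_pos <;> nlinarith [norm_nonneg a, norm_nonneg b]
  linarith

theorem hasDerivAt_moebius (a : ℂ) {b : ℂ} (h : 1 - conj a * b ≠ 0) :
    HasDerivAt (fun u => (u - a) / (1 - conj a * u))
      ((1 - conj a * a) / (1 - conj a * b) ^ 2) b := by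
  have h1 : HasDerivAt (fun u : ℂ => u - a) 1 b := (hasDerivAt_id b).sub_const a
  have h2 : HasDerivAt (fun u : ℂ => 1 - conj a * u) (-(conj a * 1)) b :=
    ((hasDerivAt_id b).const_mul (conj a)).const_sub 1
  exact (h1.div h2 h).congr_deriv (by ring)

theorem conj_mul_self_eq (a : ℂ) : conj a * a = ((‖a‖ ^ 2 : ℝ) : ℂ) := by
  rw [mul_comm, Complex.mul_conj, Complex.normSq_eq_norm_sq]

theorem norm_one_sub_conj_mul_self {a : ℂ} (ha : ‖a‖ < 1) : ‖1 - conj a * a‖ = 1 - ‖a‖ ^ 2 := by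
  rw [conj_mul_self_eq, ← Complex.ofReal_one, ← Complex.ofReal_sub, Complex.norm_real,
    Real.norm_of_nonneg]
  nlinarith [norm_nonneg a]

/-- The Schwarz–Pick inequality for the derivative, strict self-maps of the disc. -/
theorem norm_deriv_mul_le_of_mapsTo {Φ : ℂ → ℂ} (hd : DifferentiableOn ℂ Φ disc)
    (hb : MapsTo Φ disc disc) {z : ℂ} (hz : z ∈ disc) :
    ‖deriv Φ z‖ * (1 - ‖z‖ ^ 2) ≤ 1 - ‖Φ z‖ ^ 2 := by
  have hz' := mem_disc.mp hz
  have hβ := mem_disc.mp (hb hz)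
  have hnz : ‖-z‖ < 1 := by rwa [norm_neg]
  -- `S` sends 0 to z and `T` sends Φ(z) to 0, so the Schwarz lemma applies to `T ∘ Φ ∘ S` at the
  -- origin.
  set S : ℂ → ℂ := fun u => (u - (-z)) / (1 - conj (-z) * u) with hS
  set T : ℂ → ℂ := fun u => (u - Φ z) / (1 - conj (Φ z) * u) with hT
  have hS0 : S 0 = z := by simp [hS]
  have hSm : MapsTo S disc disc := fun u hu =>
    mem_disc.mpr (norm_moebius_lt_one hnz (mem_disc.mp hu))
  have hTm : MapsTo T disc disc := fun u hu =>
    mem_disc.mpr (norm_moebius_lt_one hβ (mem_disc.mp hu))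
  have hSd : DifferentiableOn ℂ S disc := fun u hu =>
    (hasDerivAt_moebius (-z)
      (one_sub_conj_mul_ne_zero hnz (mem_disc.mp hu).le)).differentiableAt.differentiableWithinAt
  have hTd : DifferentiableOn ℂ T disc := fun u hu =>
    (hasDerivAt_moebius (Φ z)
      (one_sub_conj_mul_ne_zero hβ (mem_disc.mp hu).le)).differentiableAt.differentiableWithinAt
  have hF : DifferentiableOn ℂ (T ∘ Φ ∘ S) disc := hTd.comp (hd.comp hSd hSm) (hb.comp hSm)
  have hF0 : (T ∘ Φ ∘ S) 0 = 0 := by simp [hS0, hT]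
  have hmap : MapsTo (T ∘ Φ ∘ S) (ball 0 1) (closedBall ((T ∘ Φ ∘ S) 0) 1) := by
    rw [hF0]
    exact fun u hu => ball_subset_closedBall ((hTm.comp (hb.comp hSm)) hu)
  have key := Complex.norm_deriv_le_one_of_mapsTo_ball hF hmap one_pos
  have dS : HasDerivAt S (1 - conj z * z) 0 := by
    have := hasDerivAt_moebius (-z) (b := 0) (by simp)
    simpa [hS] using this
  have dΦ : HasDerivAt Φ (deriv Φ z) (S 0) := by
    rw [hS0]
    exact (hd.differentiableAt (isOpen_ball.mem_nhds hz)).hasDerivAt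
  have dT : HasDerivAt T ((1 - conj (Φ z) * Φ z) / (1 - conj (Φ z) * Φ z) ^ 2) ((Φ ∘ S) 0) := by
    have e : (Φ ∘ S) 0 = Φ z := by simp [hS0]
    rw [e]
    exact hasDerivAt_moebius (Φ z) (one_sub_conj_mul_ne_zero hβ hβ.le)
  have dF := dT.comp 0 (dΦ.comp 0 dS)
  rw [dF.deriv, norm_mul, norm_mul, norm_div, norm_pow, norm_one_sub_conj_mul_self hβ,
    norm_one_sub_conj_mul_self hz'] at key
  have hpos : 0 < 1 - ‖Φ z‖ ^ 2 := by nlinarith [norm_nonneg (Φ z)]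
  have e : (1 - ‖Φ z‖ ^ 2) / (1 - ‖Φ z‖ ^ 2) ^ 2 * (‖deriv Φ z‖ * (1 - ‖z‖ ^ 2))
      = (‖deriv Φ z‖ * (1 - ‖z‖ ^ 2)) / (1 - ‖Φ z‖ ^ 2) := by
    field_simp
  rw [e, div_le_one hpos] at key
  exact key

/-- The Schwarz–Pick inequality for the derivative. -/
theorem norm_deriv_mul_le {Φ : ℂ → ℂ} (hd : DifferentiableOn ℂ Φ disc)
    (hb : ∀ z ∈ disc, ‖Φ z‖ ≤ 1) {z : ℂ} (hz : z ∈ disc) :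
    ‖deriv Φ z‖ * (1 - ‖z‖ ^ 2) ≤ 1 - ‖Φ z‖ ^ 2 := by
  -- For c < 1 the function cΦ maps into the open disc, even if Φ is a unimodular constant; then c →
  -- 1.
  have h : ∀ c ∈ Ioo (0 : ℝ) 1, c * (‖deriv Φ z‖ * (1 - ‖z‖ ^ 2)) ≤ 1 - (c * ‖Φ z‖) ^ 2 := by
    intro c hc
    have hm : MapsTo (fun u => (c : ℂ) * Φ u) disc disc := by
      intro u hu
      rw [mem_disc, norm_mul, Complex.norm_real, Real.norm_of_nonneg hc.1.le]
      nlinarith [hb u hu, hc.1, hc.2, norm_nonneg (Φ u)]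
    have := norm_deriv_mul_le_of_mapsTo (hd.const_mul (c : ℂ)) hm hz
    rw [deriv_const_mul_field, norm_mul, norm_mul, Complex.norm_real,
      Real.norm_of_nonneg hc.1.le] at this
    linarith
  have h1 : Filter.Tendsto (fun c : ℝ => c * (‖deriv Φ z‖ * (1 - ‖z‖ ^ 2))) (nhdsWithin 1 (Iio 1))
      (nhds (1 * (‖deriv Φ z‖ * (1 - ‖z‖ ^ 2)))) :=
    ((continuous_id.mul continuous_const).tendsto 1).mono_left nhdsWithin_le_nhds
  have h2 : Filter.Tendsto (fun c : ℝ => 1 - (c * ‖Φ z‖) ^ 2) (nhdsWithin 1 (Iio 1))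
      (nhds (1 - (1 * ‖Φ z‖) ^ 2)) :=
    ((continuous_const.sub ((continuous_id.mul continuous_const).pow 2)).tendsto 1).mono_left
      nhdsWithin_le_nhds
  have := le_of_tendsto_of_tendsto h1 h2
    (Filter.eventually_of_mem (Ioo_mem_nhdsLT zero_lt_one) h)
  simpa using this

/-- Dieudonné's inequality: the derivative of a Schwarz function. -/
theorem norm_mul_deriv_sub_le {ω : ℂ → ℂ} (hd : DifferentiableOn ℂ ω disc) (h0 : ω 0 = 0)
    (hb : ∀ z ∈ disc, ‖ω z‖ ≤ ‖z‖) {z : ℂ} (hz : z ∈ disc) :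
    ‖z * deriv ω z - ω z‖ ≤ (‖z‖ ^ 2 - ‖ω z‖ ^ 2) / (1 - ‖z‖ ^ 2) := by
  have hz' := mem_disc.mp hz
  -- With ω = zB and |B| ≤ 1, the quantity zω' - ω equals z²B', so Schwarz–Pick for B gives the
  -- bound.
  set B := dslope ω 0 with hB
  have hBd : DifferentiableOn ℂ B disc :=
    (Complex.differentiableOn_dslope (ball_mem_nhds 0 one_pos)).mpr hd
  have hmap : MapsTo ω (ball 0 1) (closedBall (ω 0) 1) := by
    intro u hu
    rw [h0, mem_closedBall_zero_iff]
    exact (hb u hu).trans (mem_disc.mp hu).le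
  have hB1 : ∀ u ∈ disc, ‖B u‖ ≤ 1 := fun u hu => by
    simpa using Complex.norm_dslope_le_div_of_mapsTo_ball hd hmap hu
  have e : ∀ u, ω u = u * B u := fun u => by
    have := sub_smul_dslope ω 0 u
    simpa [h0] using this.symm
  have hB' := (hBd.differentiableAt (isOpen_ball.mem_nhds hz)).hasDerivAt
  have hω' : HasDerivAt ω (1 * B z + z * deriv B z) z := by
    rw [show ω = fun u => u * B u from funext e]
    exact (hasDerivAt_id z).mul hB'
  have key := norm_deriv_mul_le hBd hB1 hz
  have hpos : 0 < 1 - ‖z‖ ^ 2 := by nlinarith [norm_nonneg z]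
  rw [hω'.deriv, e z, show z * (1 * B z + z * deriv B z) - z * B z = z ^ 2 * deriv B z by ring,
    norm_mul, norm_mul, norm_pow, le_div_iff₀ hpos]
  nlinarith [sq_nonneg ‖z‖]

/-! ### Reduction to a growth estimate, and the barrier along rays -/

/-- The derivative of the modulus of a nonvanishing function of a real variable. -/
theorem _root_.HasDerivAt.norm_of_ne_zero {g : ℝ → ℂ} {g' : ℂ} {t : ℝ} (h : HasDerivAt g g' t)
    (h0 : g t ≠ 0) : HasDerivAt (fun x => ‖g x‖) (‖g t‖ * (g' / g t).re) t := by
  have h1 := h.norm_sq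
  have h2 : HasDerivAt (fun x => √(‖g x‖ ^ 2)) _ t := h1.sqrt (by positivity)
  simp only [Real.sqrt_sq (norm_nonneg _)] at h2
  convert h2 using 1
  have h3 : inner ℝ (g t) g' = ‖g t‖ ^ 2 * (g' / g t).re := by
    rw [Complex.div_re, ← Complex.normSq_eq_norm_sq, Complex.inner]
    have : Complex.normSq (g t) ≠ 0 := by simpa using h0
    simp
    field_simp
  rw [h3]
  have : ‖g t‖ ≠ 0 := by simpa using h0
  field_simp

/-- Here g' = Φ'f + Φf'. With a = |Φ(z)|, Schwarz–Pick and the hypothesis bound |g'| by ((1 - a²)/2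
+ a)|f'|, and (1 - a²)/2 + a = 1 - (1 - a)²/2. -/
theorem norm_deriv_le_of_majorized {f g : ℂ → ℂ} (hf : DifferentiableOn ℂ f disc)
    (hg : Majorized g f) {z : ℂ} (hz : z ∈ disc)
    (h : 2 * ‖f z‖ ≤ (1 - ‖z‖ ^ 2) * ‖deriv f z‖) : ‖deriv g z‖ ≤ ‖deriv f z‖ := by
  obtain ⟨Φ, hΦd, hΦ1, hgf⟩ := hg
  have hnhds : disc ∈ nhds z := isOpen_ball.mem_nhds hz
  have hd : HasDerivAt g (deriv Φ z * f z + Φ z * deriv f z) z :=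
    ((hΦd.differentiableAt hnhds).hasDerivAt.mul
      (hf.differentiableAt hnhds).hasDerivAt).congr_of_eventuallyEq
      (Filter.eventually_of_mem hnhds hgf)
  have hsp := norm_deriv_mul_le hΦd hΦ1 hz
  rw [hd.deriv]
  have h1 : ‖deriv Φ z * f z + Φ z * deriv f z‖ ≤ ‖deriv Φ z‖ * ‖f z‖ + ‖Φ z‖ * ‖deriv f z‖ := by
    simpa using norm_add_le (deriv Φ z * f z) (Φ z * deriv f z)
  have h2 := mul_le_mul_of_nonneg_left h (norm_nonneg (deriv Φ z))
  have h3 := mul_le_mul_of_nonneg_right hsp (norm_nonneg (deriv f z))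
  have h4 := mul_nonneg (sq_nonneg (1 - ‖Φ z‖)) (norm_nonneg (deriv f z))
  nlinarith

theorem hasDerivAt_conjSum_div_two {f : ℂ → ℂ} (hf : DifferentiableOn ℂ f disc) {u : ℂ}
    (hu : u ∈ disc) :
    HasDerivAt (fun v => conjSum f v / 2) ((deriv f u + conj (deriv f (conj u))) / 2) u := by
  have hu' : conj u ∈ disc := conj_mem_disc hu
  have h1 := (hf.differentiableAt (isOpen_ball.mem_nhds hu)).hasDerivAt
  have h2 := (hf.differentiableAt (isOpen_ball.mem_nhds hu')).hasDerivAt.conj_conj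
  rw [Complex.conj_conj] at h2
  exact (h1.add h2).div_const 2

/-- A function in the class satisfies `f' = k ψ(ω)`, where `z k(z)` is the symmetrization of `f`. -/
theorem exists_factorization {ψ f : ℂ → ℂ} (hf : f ∈ starlikeConj ψ) :
    ψ 0 = 1 ∧ ∃ ω k : ℂ → ℂ, (DifferentiableOn ℂ ω disc ∧ ω 0 = 0 ∧ ∀ z ∈ disc, ‖ω z‖ ≤ ‖z‖) ∧
      DifferentiableOn ℂ k disc ∧
      ∀ u ∈ disc, k u ≠ 0 ∧ deriv f u = k u * ψ (ω u) ∧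
        (1 + u * (deriv k u / k u)).re = ((ψ (ω u)).re + (ψ (ω (conj u))).re) / 2 := by
  obtain ⟨⟨hfd, hf0, hf1⟩, hne, ω, hωd, hω0, hωb, hq⟩ := hf
  have h0mem : (0 : ℂ) ∈ disc := mem_ball_self one_pos
  have hψ0 : ψ 0 = 1 := by simpa [hω0, conjQuotient] using (hq 0 h0mem).symm
  refine ⟨hψ0, ω, dslope (fun v => conjSum f v / 2) 0, ⟨hωd, hω0, hωb⟩, ?_, ?_⟩
  · exact (Complex.differentiableOn_dslope (ball_mem_nhds 0 one_pos)).mpr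
      fun u hu => (hasDerivAt_conjSum_div_two hfd hu).differentiableAt.differentiableWithinAt
  set h : ℂ → ℂ := fun v => conjSum f v / 2 with hh
  set k := dslope h 0 with hk
  have hkd : DifferentiableOn ℂ k disc :=
    (Complex.differentiableOn_dslope (ball_mem_nhds 0 one_pos)).mpr
      fun u hu => (hasDerivAt_conjSum_div_two hfd hu).differentiableAt.differentiableWithinAt
  have hh0 : h 0 = 0 := by simp [hh, conjSum, hf0]
  have hfac : ∀ u, h u = u * k u := fun u => by
    simpa [hh0] using (sub_smul_dslope h 0 u).symm
  have hk0 : k 0 = 1 := by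
    rw [hk, dslope_same, (hasDerivAt_conjSum_div_two hfd h0mem).deriv]
    simp [hf1]
  have hkne : ∀ u ∈ disc, k u ≠ 0 := by
    intro u hu hku
    by_cases hu0 : u = 0
    · rw [hu0, hk0] at hku
      exact one_ne_zero hku
    · apply hne u hu hu0
      have := hfac u
      rw [hku, mul_zero] at this
      simpa [hh] using this
  have hder : ∀ u ∈ disc, deriv f u = k u * ψ (ω u) := by
    intro u hu
    by_cases hu0 : u = 0
    · simp [hu0, hf1, hk0, hω0, hψ0]
    · have h1 := hq u hu
      have h2 : conjSum f u = 2 * (u * k u) := by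
        rw [← hfac u]
        simp only [hh]
        ring
      have := hkne u hu
      rw [conjQuotient, if_neg hu0, h2] at h1
      rw [← h1]
      field_simp
  -- The symmetrization commutes with conjugation, hence so does k.
  have hconj : ∀ u, conj (k (conj u)) = k u := by
    intro u
    by_cases hu0 : u = 0
    · simp [hu0, hk0]
    · have h1 : conj (h (conj u)) = h u := by
        simp [hh, conjSum, add_comm, map_ofNat]
      rw [hfac, hfac, map_mul, Complex.conj_conj] at h1
      exact mul_left_cancel₀ hu0 h1
  intro u hu
  refine ⟨hkne u hu, hder u hu, ?_⟩
  have hu' : conj u ∈ disc := conj_mem_disc hu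
  have d1 := hasDerivAt_conjSum_div_two hfd hu
  have d2 : HasDerivAt h (1 * k u + u * deriv k u) u := by
    rw [show h = fun u => u * k u from funext hfac]
    exact (hasDerivAt_id u).mul (hkd.differentiableAt (isOpen_ball.mem_nhds hu)).hasDerivAt
  -- Two expressions for h': the average of f'(u) and the conjugate of f'(ū), and k + uk'. Dividing
  -- by k gives the formula for 1 + uk'/k.
  have e := d1.unique d2
  rw [hder u hu, hder _ hu', map_mul, hconj] at e
  have hku := hkne u hu
  have e2 : 1 + u * (deriv k u / k u) = (ψ (ω u) + conj (ψ (ω (conj u)))) / 2 := by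
    field_simp
    linear_combination (-2) * e
  rw [e2]
  simp

/-- Growth estimate along rays by a barrier argument. -/
theorem mul_norm_le_norm_mul_deriv {ψ dψ : ℂ → ℂ} {m dm β dβ : ℝ → ℝ} {ρ : ℝ} (hρ1 : ρ < 1)
    (hψ : ∀ w, ‖w‖ ≤ ρ → HasDerivAt ψ (dψ w) w)
    (hm : ∀ s ∈ Icc 0 ρ, HasDerivAt m (dm s) s) (hmpos : ∀ s ∈ Icc 0 ρ, 0 < m s)
    (hre : ∀ s ∈ Icc 0 ρ, ∀ w, ‖w‖ ≤ s → m s ≤ (ψ w).re)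
    (hβ : ∀ s ∈ Icc 0 ρ, HasDerivAt β (dβ s) s) (hβ01 : ∀ s ∈ Icc 0 ρ, β s ∈ Icc (0 : ℝ) 1)
    (hbar : ∀ s ∈ Icc 0 ρ, ∀ w ζ : ℂ, ‖w‖ ≤ s → ‖ζ‖ ≤ (s ^ 2 - ‖w‖ ^ 2) / (1 - s ^ 2) →
      ‖ψ w‖ ≤ s * dβ s * (‖ψ w‖ / m s - 1)
        + β s * (‖ψ w‖ / m s) * (((w + ζ) * (dψ w / ψ w)).re - s * dm s / m s)
        + (1 + β s * (‖ψ w‖ / m s - 1)) * m s)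
    {f : ℂ → ℂ} (hf : f ∈ starlikeConj ψ) {z : ℂ} (hz : ‖z‖ ≤ ρ) :
    m ‖z‖ * ‖f z‖ ≤ ‖z‖ * ‖deriv f z‖ := by
  obtain ⟨-, ω, k, ⟨hωd, hω0, hωb⟩, hkd, hfac⟩ := exists_factorization hf
  obtain ⟨⟨hfd, hf0, -⟩, -, -⟩ := hf
  have hnorm : ∀ t ∈ Icc (0 : ℝ) 1, ‖(t : ℂ) * z‖ = t * ‖z‖ := fun t ht => by
    rw [norm_mul, Complex.norm_real, Real.norm_of_nonneg ht.1]
  have hs : ∀ t ∈ Icc (0 : ℝ) 1, t * ‖z‖ ∈ Icc 0 ρ := fun t ht =>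
    ⟨mul_nonneg ht.1 (norm_nonneg z), (mul_le_of_le_one_left (norm_nonneg z) ht.2).trans hz⟩
  have hmem : ∀ t ∈ Icc (0 : ℝ) 1, (t : ℂ) * z ∈ disc := fun t ht => by
    rw [mem_disc, hnorm t ht]
    exact (hs t ht).2.trans_lt hρ1
  have hωs : ∀ t ∈ Icc (0 : ℝ) 1, ‖ω (t * z)‖ ≤ t * ‖z‖ := fun t ht =>
    (hωb _ (hmem t ht)).trans (hnorm t ht).le
  have hre' : ∀ t ∈ Icc (0 : ℝ) 1, m (t * ‖z‖) ≤ (ψ (ω (t * z))).re := fun t ht =>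
    hre _ (hs t ht) _ (hωs t ht)
  have hmn : ∀ t ∈ Icc (0 : ℝ) 1, m (t * ‖z‖) ≤ ‖ψ (ω (t * z))‖ := fun t ht =>
    (hre' t ht).trans (Complex.re_le_norm _)
  have hψne : ∀ t ∈ Icc (0 : ℝ) 1, ψ (ω (t * z)) ≠ 0 := fun t ht =>
    norm_pos_iff.mp ((hmpos _ (hs t ht)).trans_le (hmn t ht))
  have hray : ∀ t : ℝ, HasDerivAt (fun x : ℝ => (x : ℂ) * z) z t := fun t => by
    simpa using (Complex.ofRealCLM.hasDerivAt (x := t)).mul_const z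
  have hrayr : ∀ t : ℝ, HasDerivAt (fun x : ℝ => x * ‖z‖) ‖z‖ t := fun t => by
    simpa using (hasDerivAt_id t).mul_const ‖z‖
  have hcomp : ∀ {g : ℂ → ℂ}, DifferentiableOn ℂ g disc → ∀ t ∈ Icc (0 : ℝ) 1,
      HasDerivAt (fun x : ℝ => g (x * z)) (deriv g (t * z) * z) t := fun {g} hg t ht =>
    HasDerivAt.comp t (hg.differentiableAt (isOpen_ball.mem_nhds (hmem t ht))).hasDerivAt (hray t)
  -- The barrier is Γ(t) · |h(tz)|. It interpolates between |h| at β = 0 and |tz f'(tz)|/m at β = 1.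
  set Γ : ℝ → ℝ := fun t => 1 + β (t * ‖z‖) * (‖ψ (ω (t * z))‖ / m (t * ‖z‖) - 1) with hΓ
  set n : ℝ → ℝ := fun t => ‖ψ (ω (t * z))‖ with hn
  set L : ℝ → ℝ := fun t => (dψ (ω (t * z)) * (deriv ω (t * z) * z) / ψ (ω (t * z))).re with hL
  set dΓ : ℝ → ℝ := fun t => dβ (t * ‖z‖) * ‖z‖ * (n t / m (t * ‖z‖) - 1)
    + β (t * ‖z‖) * ((n t * L t * m (t * ‖z‖) - n t * (dm (t * ‖z‖) * ‖z‖)) / m (t * ‖z‖) ^ 2)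
    with hdΓ
  have hΓd : ∀ t ∈ Icc (0 : ℝ) 1, HasDerivAt Γ (dΓ t) t := by
    intro t ht
    have d1 : HasDerivAt (fun x : ℝ => ψ (ω (x * z)))
        (dψ (ω (t * z)) * (deriv ω (t * z) * z)) t :=
      HasDerivAt.comp t (hψ _ ((hωs t ht).trans (hs t ht).2)) (hcomp hωd t ht)
    have d2 : HasDerivAt n (n t * L t) t := d1.norm_of_ne_zero (hψne t ht)
    have d3 : HasDerivAt (fun x : ℝ => m (x * ‖z‖)) (dm (t * ‖z‖) * ‖z‖) t :=
      HasDerivAt.comp t (hm _ (hs t ht)) (hrayr t)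
    have d4 : HasDerivAt (fun x : ℝ => β (x * ‖z‖)) (dβ (t * ‖z‖) * ‖z‖) t :=
      HasDerivAt.comp t (hβ _ (hs t ht)) (hrayr t)
    exact (d4.mul ((d2.div d3 (hmpos _ (hs t ht)).ne').sub_const 1)).const_add 1
  set B : ℝ → ℝ := fun t => Γ t * (t * ‖z‖ * ‖k (t * z)‖) with hB
  set dB : ℝ → ℝ := fun t => dΓ t * (t * ‖z‖ * ‖k (t * z)‖) + Γ t * (‖z‖ * ‖k (t * z)‖
    + t * ‖z‖ * (‖k (t * z)‖ * (deriv k (t * z) * z / k (t * z)).re)) with hdB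
  have hBd : ∀ t ∈ Icc (0 : ℝ) 1, HasDerivAt B (dB t) t := fun t ht =>
    (hΓd t ht).mul ((hrayr t).mul
      ((hcomp hkd t ht).norm_of_ne_zero (hfac _ (hmem t ht)).1))
  have hbound : ∀ t ∈ Ico (0 : ℝ) 1, ‖deriv f (t * z) * z‖ ≤ dB t := by
    intro t ht'
    have ht : t ∈ Icc (0 : ℝ) 1 := Ico_subset_Icc_self ht'
    obtain ⟨-, hder, hQ⟩ := hfac _ (hmem t ht)
    have hconj : conj ((t : ℂ) * z) = t * conj z := by simp
    -- Both ω(tz) and ω of the conjugate point have modulus at most t|z|, so the lower bound for Re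
    -- ψ applies to both terms of the mean.
    have hQm : m (t * ‖z‖) ≤ (1 + t * z * (deriv k (t * z) / k (t * z))).re := by
      have hc : m (t * ‖z‖) ≤ (ψ (ω (conj ((t : ℂ) * z)))).re := by
        have e : ‖conj ((t : ℂ) * z)‖ = t * ‖z‖ := by rw [Complex.norm_conj, hnorm t ht]
        refine hre _ (hs t ht) _ ?_
        rw [← e]
        exact hωb _ (by rw [mem_disc, e]; exact (hs t ht).2.trans_lt hρ1)
      rw [hQ]
      linarith [hre' t ht]
    have hdie := norm_mul_deriv_sub_le hωd hω0 hωb (hmem t ht)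
    rw [hnorm t ht] at hdie
    have hb := hbar _ (hs t ht) _ _ (hωs t ht) hdie
    have hmp := hmpos _ (hs t ht)
    have hΓ0 : 0 ≤ Γ t := by
      have h1 : 1 ≤ n t / m (t * ‖z‖) := (one_le_div hmp).mpr (hmn t ht)
      have := mul_nonneg (hβ01 _ (hs t ht)).1 (sub_nonneg.mpr h1)
      simp only [hΓ]
      linarith
    have hL' : ((ω (t * z) + (t * z * deriv ω (t * z) - ω (t * z)))
        * (dψ (ω (t * z)) / ψ (ω (t * z)))).re = t * L t := by
      simp only [hL]
      rw [← Complex.re_ofReal_mul]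
      congr 1
      ring
    have hK' : (1 + t * z * (deriv k (t * z) / k (t * z))).re
        = 1 + t * (deriv k (t * z) * z / k (t * z)).re := by
      rw [← Complex.re_ofReal_mul, Complex.add_re, Complex.one_re]
      congr 2
      ring
    rw [hL'] at hb
    rw [hK'] at hQm
    have hQΓ := mul_le_mul_of_nonneg_left hQm hΓ0
    -- This is |f'(tz) z| ≤ B'(t) divided by |z||k(tz)|; the term 1 + t Re(zk'/k) has been bounded
    -- below by m, using Γ ≥ 0.
    have hfin : n t ≤ t * dΓ t + Γ t * (1 + t * (deriv k (t * z) * z / k (t * z)).re) := by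
      refine hb.trans ?_
      have e : t * dΓ t = t * ‖z‖ * dβ (t * ‖z‖) * (n t / m (t * ‖z‖) - 1)
          + β (t * ‖z‖) * (n t / m (t * ‖z‖))
            * (t * L t - t * ‖z‖ * dm (t * ‖z‖) / m (t * ‖z‖)) := by
        simp only [hdΓ]
        field_simp
      rw [e]
      linarith
    have hmul := mul_le_mul_of_nonneg_left hfin
      (mul_nonneg (norm_nonneg z) (norm_nonneg (k (t * z))))
    rw [hder, norm_mul, norm_mul]
    simp only [hdB]
    simp only [hn] at hmul
    linarith
  have hmain := image_norm_le_of_norm_deriv_right_le_deriv_boundary'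
    (f := fun t : ℝ => f (t * z)) (a := 0) (b := 1)
    (fun t ht => (hcomp hfd t ht).continuousAt.continuousWithinAt)
    (fun t ht => (hcomp hfd t (Ico_subset_Icc_self ht)).hasDerivWithinAt)
    (B := B) (B' := dB) (by simp [hB, hf0])
    (fun t ht => (hBd t ht).continuousAt.continuousWithinAt)
    (fun t ht => (hBd t (Ico_subset_Icc_self ht)).hasDerivWithinAt) hbound
    (right_mem_Icc.mpr zero_le_one)
  have h1 : (1 : ℝ) ∈ Icc (0 : ℝ) 1 := right_mem_Icc.mpr zero_le_one
  have hb1 := hβ01 _ (hs 1 h1)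
  have hmp := hmpos _ (hs 1 h1)
  have hmn1 := hmn 1 h1
  obtain ⟨-, hder, -⟩ := hfac _ (hmem 1 h1)
  simp only [hB, hΓ, Complex.ofReal_one, one_mul] at hmain hb1 hmp hmn1 hder
  rw [hder, norm_mul]
  -- Since β ≤ 1 and |ψ(ω)| ≥ m, the barrier at t = 1 is at most |z f'(z)|/m.
  have hΓ1 : 1 + β ‖z‖ * (‖ψ (ω z)‖ / m ‖z‖ - 1) ≤ ‖ψ (ω z)‖ / m ‖z‖ := by
    have h2 : 1 ≤ ‖ψ (ω z)‖ / m ‖z‖ := (one_le_div hmp).mpr hmn1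
    nlinarith [mul_nonneg (sub_nonneg.mpr hb1.2) (sub_nonneg.mpr h2)]
  have h3 : ‖f z‖ ≤ ‖ψ (ω z)‖ / m ‖z‖ * (‖z‖ * ‖k z‖) :=
    hmain.trans (mul_le_mul_of_nonneg_right hΓ1 (by positivity))
  calc m ‖z‖ * ‖f z‖ ≤ m ‖z‖ * (‖ψ (ω z)‖ / m ‖z‖ * (‖z‖ * ‖k z‖)) := by gcongr
    _ = ‖z‖ * (‖k z‖ * ‖ψ (ω z)‖) := by field_simp

/-! ### Extremal functions and sharpness -/

/-- The extremal function `z exp (∫ (ψ - 1) / t)` of the class: it is real and `ω` is the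
identity. -/
theorem exists_mem_starlikeConj {ψ : ℂ → ℂ} (hψ : DifferentiableOn ℂ ψ disc) (hψ0 : ψ 0 = 1)
    (hconj : ∀ w ∈ disc, ψ (conj w) = conj (ψ w)) :
    ∃ F : ℂ → ℂ, (fun u => u * exp (F u)) ∈ starlikeConj ψ ∧
      ∀ u ∈ disc, HasDerivAt (fun u => u * exp (F u)) (exp (F u) * ψ u) u := by
  have h0 : (0 : ℂ) ∈ disc := mem_ball_self one_pos
  set G := dslope ψ 0 with hG
  have hGd : DifferentiableOn ℂ G disc :=
    (Complex.differentiableOn_dslope (ball_mem_nhds 0 one_pos)).mpr hψ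
  have hGψ : ∀ u, u * G u = ψ u - 1 := fun u => by
    simpa [hψ0] using sub_smul_dslope ψ 0 u
  have hGc : ∀ u ∈ disc, conj (G (conj u)) = G u := by
    intro u hu
    by_cases hu0 : u = 0
    · have e : (conj ∘ ψ ∘ conj) =ᶠ[nhds 0] ψ :=
        Filter.eventually_of_mem (isOpen_ball.mem_nhds h0) fun w hw => by
          simp [hconj w hw]
      have e2 := e.deriv_eq
      rw [deriv_conj_conj] at e2
      simpa [hu0, hG] using e2
    · have h1 := congrArg conj (hGψ (conj u))
      rw [hconj u hu, map_mul, map_sub, Complex.conj_conj, Complex.conj_conj, map_one, ← hGψ u] at h1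
      exact mul_left_cancel₀ hu0 h1
  obtain ⟨F, hF0, hF⟩ := (hGd.isExactOn_ball).with_val_at 0 0
  -- Both sides have derivative (ψ - 1)/u and vanish at 0. Thus F is symmetric, and `conjSum` of the
  -- extremal function is twice that function.
  have hFc : EqOn (conj ∘ F ∘ conj) F disc := by
    have hd : ∀ u ∈ disc, HasDerivAt (conj ∘ F ∘ conj) (G u) u := fun u hu => by
      have := (hF _ (conj_mem_disc hu)).conj_conj
      rwa [Complex.conj_conj, hGc u hu] at this
    refine isOpen_ball.eqOn_of_deriv_eq (convex_ball _ _).isPreconnected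
      (fun u hu => (hd u hu).differentiableAt.differentiableWithinAt)
      (fun u hu => (hF u hu).differentiableAt.differentiableWithinAt)
      (fun u hu => ?_) h0 (by simp [hF0])
    rw [(hd u hu).deriv, (hF u hu).deriv]
  have hd : ∀ u ∈ disc, HasDerivAt (fun u => u * exp (F u)) (exp (F u) * ψ u) u := by
    intro u hu
    refine ((hasDerivAt_id u).mul (hF u hu).cexp).congr_deriv ?_
    have := hGψ u
    simp only [id]
    linear_combination exp (F u) * this
  have hsum : ∀ u ∈ disc, conjSum (fun u => u * exp (F u)) u = 2 * (u * exp (F u)) := by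
    intro u hu
    have e : conj (F (conj u)) = F u := hFc hu
    simp only [conjSum, map_mul, ← Complex.exp_conj, Complex.conj_conj, e]
    ring
  refine ⟨F, ⟨⟨fun u hu => (hd u hu).differentiableAt.differentiableWithinAt, by simp, ?_⟩, ?_,
    id, differentiableOn_id, rfl, fun z _ => le_rfl, ?_⟩, hd⟩
  · rw [(hd 0 h0).deriv]
    simp [hF0, hψ0]
  · intro u hu hu0
    rw [hsum u hu]
    exact mul_ne_zero two_ne_zero (mul_ne_zero hu0 (exp_ne_zero _))
  · intro u hu
    by_cases hu0 : u = 0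
    · simp [conjQuotient, hu0, hψ0]
    · rw [conjQuotient, if_neg hu0, (hd u hu).deriv, hsum u hu]
      have := exp_ne_zero (F u)
      simp only [id]
      field_simp

/-- A self-map of the disc with prescribed real value at `-r` and extremal derivative. -/
theorem exists_extremal_multiplier {r b : ℝ} (hr0 : 0 ≤ r) (hr1 : r < 1) (hb0 : 0 ≤ b)
    (hb1 : b < 1) :
    ∃ Φ : ℂ → ℂ, DifferentiableOn ℂ Φ disc ∧ (∀ z ∈ disc, ‖Φ z‖ ≤ 1) ∧ Φ (-(r : ℂ)) = b ∧
      deriv Φ (-(r : ℂ)) = ((-((1 - b ^ 2) / (1 - r ^ 2)) : ℝ) : ℂ) := by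
  have hr : ‖(-(r : ℂ))‖ < 1 := by
    rwa [norm_neg, Complex.norm_real, Real.norm_of_nonneg hr0]
  have hb : ‖(b : ℂ)‖ < 1 := by
    rwa [Complex.norm_real, Real.norm_of_nonneg hb0]
  set T : ℂ → ℂ := fun u => (u - (-(r : ℂ))) / (1 - conj (-(r : ℂ)) * u) with hT
  set S : ℂ → ℂ := fun u => (u - (b : ℂ)) / (1 - conj (b : ℂ) * u) with hS
  have hTm : ∀ u ∈ disc, ‖T u‖ < 1 := fun u hu => norm_moebius_lt_one hr (mem_disc.mp hu)
  have hd : ∀ u ∈ disc, HasDerivAt (fun u => -S (T u))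
      (-((1 - conj (b : ℂ) * b) / (1 - conj (b : ℂ) * T u) ^ 2
        * ((1 - conj (-(r : ℂ)) * (-(r : ℂ))) / (1 - conj (-(r : ℂ)) * u) ^ 2))) u := fun u hu =>
    (HasDerivAt.comp u
      (hasDerivAt_moebius (b : ℂ) (one_sub_conj_mul_ne_zero hb (hTm u hu).le))
      (hasDerivAt_moebius (-(r : ℂ)) (one_sub_conj_mul_ne_zero hr (mem_disc.mp hu).le))).neg
  -- The sign makes Φ'(-r) negative. As u exp(F u) is -r exp(F(-r)) at u = -r, the two terms of g'
  -- then reinforce each other.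
  refine ⟨fun u => -S (T u), fun u hu => (hd u hu).differentiableAt.differentiableWithinAt,
    fun u hu => ?_, ?_, ?_⟩
  · rw [norm_neg]
    exact (norm_moebius_lt_one hb (hTm u hu)).le
  · simp [hS, hT]
  · rw [(hd _ (mem_disc.mpr hr)).deriv]
    have h1 : (1 - (r : ℂ) ^ 2) ≠ 0 := by
      have : (1 - r ^ 2 : ℝ) ≠ 0 := by nlinarith
      exact_mod_cast this
    have h2 : (1 - (r : ℂ) * r) ≠ 0 := by simpa [sq] using h1
    simp [hT]
    field_simp

/-- At -r, up to the common factor exp(F(-r)), f' is m(r) and g' is (1 - b²)r/(1 - r²) + b m(r),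
where b = Φ(-r). Their difference is positive for a suitable b < 1 exactly because (1 - r²)m(r) <
2r. -/
theorem isSharpRadius_of_lt {ψ : ℂ → ℂ} {m : ℝ → ℝ} {ρ : ℝ} (hψ : DifferentiableOn ℂ ψ disc)
    (hψ0 : ψ 0 = 1) (hconj : ∀ w ∈ disc, ψ (conj w) = conj (ψ w))
    (hreal : ∀ s ∈ Ico (0 : ℝ) 1, ψ (-(s : ℂ)) = (m s : ℂ)) (hρ : 0 ≤ ρ)
    (hm : ∀ r, ρ < r → r < 1 → 0 ≤ m r ∧ (1 - r ^ 2) * m r < 2 * r) :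
    IsSharpRadius (starlikeConj ψ) ρ := by
  intro r hρr hr1
  have hr0 : 0 < r := hρ.trans_lt hρr
  obtain ⟨hm0, hmr⟩ := hm r hρr hr1
  have hr2 : 0 < 1 - r ^ 2 := by nlinarith
  obtain ⟨F, hf, hfd⟩ := exists_mem_starlikeConj hψ hψ0 hconj
  -- This b maximizes the quadratic (1 - b²)r/(1 - r²) + b m(r), and the excess over m(r) becomes
  -- r(1 - b)²/(1 - r²).
  set b : ℝ := (1 - r ^ 2) * m r / (2 * r) with hb
  have hb0 : 0 ≤ b := by positivity
  have hb1 : b < 1 := (div_lt_one (by positivity)).mpr hmr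
  obtain ⟨Φ, hΦd, hΦ1, hΦv, hΦ'⟩ := exists_extremal_multiplier hr0.le hr1 hb0 hb1
  have hnorm : ‖(-(r : ℂ))‖ = r := by
    rw [norm_neg, Complex.norm_real, Real.norm_of_nonneg hr0.le]
  have hmem : (-(r : ℂ)) ∈ disc := by rwa [mem_disc, hnorm]
  refine ⟨_, hf, fun u => Φ u * (u * exp (F u)), hΦd.mul hf.1.1, ⟨Φ, hΦd, hΦ1, fun _ _ => rfl⟩,
    -(r : ℂ), hnorm, ?_⟩
  have hg := (hΦd.differentiableAt (isOpen_ball.mem_nhds hmem)).hasDerivAt.mul (hfd _ hmem)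
  have e : deriv (fun u => Φ u * (u * exp (F u))) (-(r : ℂ))
      = exp (F (-(r : ℂ))) * (((1 - b ^ 2) / (1 - r ^ 2) * r + b * m r : ℝ) : ℂ) := by
    refine hg.deriv.trans ?_
    rw [hΦv, hΦ', hreal r ⟨hr0.le, hr1⟩]
    push_cast
    ring
  rw [e, (hfd _ hmem).deriv, hreal r ⟨hr0.le, hr1⟩, norm_mul, norm_mul, Complex.norm_real,
    Complex.norm_real, Real.norm_of_nonneg hm0]
  refine mul_lt_mul_of_pos_left (lt_of_lt_of_le ?_ (le_abs_self _)) (norm_pos_iff.mpr (exp_ne_zero _))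
  have hmb : m r = 2 * r * b / (1 - r ^ 2) := by
    rw [hb]
    field_simp
  rw [hmb, ← sub_pos]
  have : (1 - b ^ 2) / (1 - r ^ 2) * r + b * (2 * r * b / (1 - r ^ 2)) - 2 * r * b / (1 - r ^ 2)
      = r * (1 - b) ^ 2 / (1 - r ^ 2) := by
    field_simp
    ring
  rw [this]
  have : 0 < (1 - b) ^ 2 := by nlinarith
  positivity

/-! ### Criteria on ψ for the sharp majorization radius -/

/-- The radii at which the majorization inequality is to be shown. -/
structure Admissible (m : ℝ → ℝ) (s : ℝ) : Prop where
  nonneg : 0 ≤ s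
  lt_one : s < 1
  le_mul : 2 * s ≤ (1 - s ^ 2) * m s
  le_sub : 2 * s ≤ 1 - s ^ 2

/-- As m is nonnegative and decreasing, (1 - r²)m(r) decreases and meets the increasing function 2r
exactly once. Below the meeting point the growth estimate gives majorization; beyond it the strict
inequality gives sharpness. The conditions on ψ and β are only required at admissible radii. -/
theorem exists_isSharpRadius {ψ dψ : ℂ → ℂ} {m dm β dβ q : ℝ → ℝ}
    (hψ : ∀ w, ‖w‖ < 1 → HasDerivAt ψ (dψ w) w)
    (hconj : ∀ w, ‖w‖ < 1 → ψ (conj w) = conj (ψ w))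
    (hreal : ∀ s ∈ Ico (0 : ℝ) 1, ψ (-(s : ℂ)) = (m s : ℂ))
    (hmc : ContinuousOn m (Icc 0 1)) (hmd : ∀ s ∈ Ico (0 : ℝ) 1, HasDerivAt m (dm s) s)
    (hdm : ∀ s ∈ Ioo (0 : ℝ) 1, dm s ≤ 0) (hm0 : 0 < m 0) (hm1 : 0 ≤ m 1)
    (hre : ∀ s, Admissible m s → ∀ w, ‖w‖ ≤ s → m s ≤ (ψ w).re)
    (hβ : ∀ s, HasDerivAt β (dβ s) s) (hβ01 : ∀ s, Admissible m s → β s ∈ Icc (0 : ℝ) 1)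
    (hbar : ∀ s, Admissible m s → 0 < m s → ∀ w ζ : ℂ, ‖w‖ ≤ s →
      ‖ζ‖ ≤ (s ^ 2 - ‖w‖ ^ 2) / (1 - s ^ 2) →
      ‖ψ w‖ ≤ s * dβ s * (‖ψ w‖ / m s - 1)
        + β s * (‖ψ w‖ / m s) * (((w + ζ) * (dψ w / ψ w)).re - s * dm s / m s)
        + (1 + β s * (‖ψ w‖ / m s - 1)) * m s)
    (hq : ∀ r ∈ Ioo (0 : ℝ) 1, q r = 0 ↔ (1 - r ^ 2) * m r = 2 * r) :
    ∃ ρ : ℝ, IsSmallestRoot q ρ ∧ MajorizesDerivUpTo (starlikeConj ψ) ρ ∧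
      (ψ 0 = 1 → IsSharpRadius (starlikeConj ψ) ρ) := by
  have hanti : AntitoneOn m (Icc 0 1) := by
    refine antitoneOn_of_deriv_nonpos (convex_Icc 0 1) hmc (fun s hs => ?_) (fun s hs => ?_)
    · rw [interior_Icc] at hs
      exact (hmd s (Ioo_subset_Ico_self hs)).differentiableAt.differentiableWithinAt
    · rw [interior_Icc] at hs
      rw [(hmd s (Ioo_subset_Ico_self hs)).deriv]
      exact hdm s hs
  have hmnn : ∀ s ∈ Icc (0 : ℝ) 1, 0 ≤ m s := fun s hs =>
    hm1.trans (hanti hs (right_mem_Icc.mpr zero_le_one) hs.2)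
  obtain ⟨ρ, hρ, hρq⟩ : ∃ ρ ∈ Ioo (0 : ℝ) 1, (1 - ρ ^ 2) * m ρ - 2 * ρ = 0 := by
    have hc : ContinuousOn (fun r => (1 - r ^ 2) * m r - 2 * r) (Icc 0 1) :=
      ((Continuous.continuousOn (by fun_prop)).mul hmc).sub (Continuous.continuousOn (by fun_prop))
    exact intermediate_value_Ioo' zero_le_one hc ⟨by norm_num, by simpa using hm0⟩
  have hmulanti : ∀ r s, 0 ≤ r → r ≤ s → s < 1 → (1 - s ^ 2) * m s ≤ (1 - r ^ 2) * m r := by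
    intro r s hr hrs hs
    have h1 := hanti ⟨hr, hrs.trans hs.le⟩ ⟨hr.trans hrs, hs.le⟩ hrs
    have h2 := hmnn s ⟨hr.trans hrs, hs.le⟩
    apply mul_le_mul _ h1 h2 <;> nlinarith
  refine ⟨ρ, ⟨⟨hρ, (hq ρ hρ).mpr (by linarith)⟩, ?_⟩, ?_, ?_⟩
  · rintro r ⟨hr, hrq⟩
    by_contra! hlt
    have h1 := (hq r hr).mp hrq
    have h2 := hmulanti r ρ hr.1.le hlt.le hρ.2
    linarith
  · intro f hf g _ hg z hz
    -- A member of the class forces the normalization, so the majorization claim needs no separate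
    -- assumption; it is vacuous for an empty class.
    have hψ0 : ψ 0 = 1 := (exists_factorization hf).1
    have hm01 : m 0 = 1 := by
      have := hreal 0 ⟨le_rfl, one_pos⟩
      simp only [Complex.ofReal_zero, neg_zero, hψ0] at this
      exact_mod_cast this.symm
    have hadm : ∀ s ∈ Icc 0 ρ, Admissible m s := by
      intro s hs
      have hs1 : s < 1 := hs.2.trans_lt hρ.2
      have h1 : 2 * s ≤ (1 - s ^ 2) * m s := by
        have := hmulanti s ρ hs.1 hs.2 hρ.2
        linarith [hs.2]
      refine ⟨hs.1, hs1, h1, ?_⟩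
      have h2 := hanti (left_mem_Icc.mpr zero_le_one) ⟨hs.1, hs1.le⟩ hs.1
      rw [hm01] at h2
      have h3 : 0 ≤ 1 - s ^ 2 := by nlinarith [hs.1]
      linarith [mul_le_mul_of_nonneg_left h2 h3]
    have hmpos : ∀ s ∈ Icc 0 ρ, 0 < m s := by
      intro s hs
      rcases hs.1.eq_or_lt with h | h
      · rwa [← h]
      · have h1 := (hadm s hs).le_mul
        have h2 : 0 < 1 - s ^ 2 := by nlinarith [(hadm s hs).lt_one]
        by_contra! h3
        nlinarith
    have hz1 : ‖z‖ < 1 := hz.trans_lt hρ.2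
    refine norm_deriv_le_of_majorized hf.1.1 hg (mem_disc.mpr hz1) ?_
    have key := mul_norm_le_norm_mul_deriv hρ.2 (fun w hw => hψ w (hw.trans_lt hρ.2))
      (fun s hs => hmd s ⟨hs.1, hs.2.trans_lt hρ.2⟩) hmpos (fun s hs => hre s (hadm s hs))
      (fun s _ => hβ s) (fun s hs => hβ01 s (hadm s hs))
      (fun s hs => hbar s (hadm s hs) (hmpos s hs)) hf hz
    rcases (norm_nonneg z).eq_or_lt with h | h
    · have hz0 : z = 0 := norm_eq_zero.mp h.symm
      rw [hz0, hf.1.2.1]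
      simp
    · have h1 := (hadm ‖z‖ ⟨h.le, hz⟩).le_mul
      have h2 : 0 < 1 - ‖z‖ ^ 2 := by nlinarith
      have h3 := mul_le_mul_of_nonneg_right h1 (norm_nonneg (f z))
      have h4 := mul_le_mul_of_nonneg_left key h2.le
      refine le_of_mul_le_mul_left ?_ h
      linarith
  · intro hψ0
    refine isSharpRadius_of_lt (m := m)
      (fun w hw => (hψ w (mem_disc.mp hw)).differentiableAt.differentiableWithinAt) hψ0
      (fun w hw => hconj w (mem_disc.mp hw)) hreal hρ.1.le fun r hr hr1 => ⟨?_, ?_⟩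
    · exact hmnn r ⟨hρ.1.le.trans hr.le, hr1.le⟩
    · have := hmulanti ρ r hρ.1.le hr.le hr1
      linarith

/-- The case in which the logarithmic derivative of `ψ ∘ ω` is controlled directly. -/
theorem exists_isSharpRadius_of_logDeriv {ψ dψ : ℂ → ℂ} {m dm q : ℝ → ℝ}
    (hψ : ∀ w, ‖w‖ < 1 → HasDerivAt ψ (dψ w) w)
    (hconj : ∀ w, ‖w‖ < 1 → ψ (conj w) = conj (ψ w))
    (hreal : ∀ s ∈ Ico (0 : ℝ) 1, ψ (-(s : ℂ)) = (m s : ℂ))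
    (hmc : ContinuousOn m (Icc 0 1)) (hmd : ∀ s ∈ Ico (0 : ℝ) 1, HasDerivAt m (dm s) s)
    (hdm : ∀ s ∈ Ioo (0 : ℝ) 1, dm s ≤ 0) (hm0 : 0 < m 0) (hm1 : 0 ≤ m 1)
    (hre : ∀ s, Admissible m s → ∀ w, ‖w‖ ≤ s → m s ≤ (ψ w).re)
    (hlog : ∀ s, Admissible m s → 0 < m s → ∀ w ζ : ℂ, ‖w‖ ≤ s →
      ‖ζ‖ ≤ (s ^ 2 - ‖w‖ ^ 2) / (1 - s ^ 2) →
      s * dm s / m s ≤ ((w + ζ) * (dψ w / ψ w)).re)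
    (hq : ∀ r ∈ Ioo (0 : ℝ) 1, q r = 0 ↔ (1 - r ^ 2) * m r = 2 * r) :
    ∃ ρ : ℝ, IsSmallestRoot q ρ ∧ MajorizesDerivUpTo (starlikeConj ψ) ρ ∧
      (ψ 0 = 1 → IsSharpRadius (starlikeConj ψ) ρ) := by
  refine exists_isSharpRadius (β := fun _ => 1) (dβ := fun _ => 0) hψ hconj hreal hmc hmd hdm hm0
    hm1 hre (fun s => hasDerivAt_const s 1) (fun s _ => by simp) (fun s hs hms w ζ hw hζ => ?_) hq
  have h1 := mul_nonneg (div_nonneg (norm_nonneg (ψ w)) hms.le)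
    (sub_nonneg.mpr (hlog s hs hms w ζ hw hζ))
  have h2 : (1 + 1 * (‖ψ w‖ / m s - 1)) * m s = ‖ψ w‖ := by
    field_simp
    ring
  rw [h2]
  linarith

/-- The case in which the logarithmic derivative of `ψ` in `|w| ≤ s` is largest at `-s`. -/
theorem exists_isSharpRadius_of_norm_logDeriv {ψ dψ : ℂ → ℂ} {m dm q : ℝ → ℝ}
    (hψ : ∀ w, ‖w‖ < 1 → HasDerivAt ψ (dψ w) w)
    (hconj : ∀ w, ‖w‖ < 1 → ψ (conj w) = conj (ψ w))
    (hreal : ∀ s ∈ Ico (0 : ℝ) 1, ψ (-(s : ℂ)) = (m s : ℂ))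
    (hmc : ContinuousOn m (Icc 0 1)) (hmd : ∀ s ∈ Ico (0 : ℝ) 1, HasDerivAt m (dm s) s)
    (hdm : ∀ s ∈ Ioo (0 : ℝ) 1, dm s ≤ 0) (hm0 : 0 < m 0) (hm1 : 0 ≤ m 1)
    (hre : ∀ s, Admissible m s → ∀ w, ‖w‖ ≤ s → m s ≤ (ψ w).re)
    (hlog : ∀ s, Admissible m s → 0 < m s → ∀ w : ℂ, ‖w‖ ≤ s →
      ‖dψ w / ψ w‖ ≤ -dm s / m s)
    (hq : ∀ r ∈ Ioo (0 : ℝ) 1, q r = 0 ↔ (1 - r ^ 2) * m r = 2 * r) :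
    ∃ ρ : ℝ, IsSmallestRoot q ρ ∧ MajorizesDerivUpTo (starlikeConj ψ) ρ ∧
      (ψ 0 = 1 → IsSharpRadius (starlikeConj ψ) ρ) := by
  refine exists_isSharpRadius_of_logDeriv hψ hconj hreal hmc hmd hdm hm0 hm1 hre
    (fun s hs hms w ζ hw hζ => ?_) hq
  have h2 : 0 < 1 - s ^ 2 := by nlinarith [hs.nonneg, hs.lt_one]
  -- With x = |w|, the bound x + (s² - x²)/(1 - s²) ≤ s reduces to s + x ≤ 1 - s², which follows
  -- from x ≤ s and 2s ≤ 1 - s².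
  have h3 : ‖w + ζ‖ ≤ s := by
    refine (norm_add_le _ _).trans ((add_le_add_right hζ _).trans ?_)
    rw [← le_sub_iff_add_le', div_le_iff₀ h2]
    nlinarith [mul_nonneg (sub_nonneg.mpr hw) (sub_nonneg.mpr hs.le_sub),
      mul_nonneg (sub_nonneg.mpr hw) (sub_nonneg.mpr hw)]
  have h4 : ‖(w + ζ) * (dψ w / ψ w)‖ ≤ s * (-dm s / m s) := by
    rw [norm_mul]
    exact mul_le_mul h3 (hlog s hs hms w hw) (norm_nonneg _) hs.nonneg
  have h5 := (abs_le.mp ((Complex.abs_re_le_norm _).trans h4)).1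
  have h6 : s * dm s / m s = -(s * (-dm s / m s)) := by ring
  rwa [h6]

theorem sharpMajorization_of_exists {ψ : ℂ → ℂ} {q : ℝ → ℝ} (h0 : ψ 0 = 1)
    (h : ∃ ρ : ℝ, IsSmallestRoot q ρ ∧ MajorizesDerivUpTo (starlikeConj ψ) ρ ∧
      (ψ 0 = 1 → IsSharpRadius (starlikeConj ψ) ρ)) : SharpMajorization ψ q := by
  obtain ⟨ρ, h1, h2, h3⟩ := h
  exact ⟨ρ, h1, h2, h3 h0⟩

theorem abs_re_le_of_norm_le {w : ℂ} {s : ℝ} (h : ‖w‖ ≤ s) : -s ≤ w.re ∧ w.re ≤ s :=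
  abs_le.mp ((Complex.abs_re_le_norm w).trans h)

theorem re_sq_add_im_sq_le {w : ℂ} {s : ℝ} (h : ‖w‖ ≤ s) : w.re ^ 2 + w.im ^ 2 ≤ s ^ 2 := by
  have h1 : w.re ^ 2 + w.im ^ 2 = ‖w‖ ^ 2 := by
    rw [Complex.sq_norm, Complex.normSq_apply]
    ring
  rw [h1]
  gcongr

/-- The number 5/12 is a rational upper bound for √2 - 1, the positive root of 2s = 1 - s². -/
theorem Admissible.lt_five_twelfths {m : ℝ → ℝ} {s : ℝ} (h : Admissible m s) : s < 5 / 12 := by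
  nlinarith [h.le_sub, h.nonneg]

theorem norm_div_le_neg_div {a b : ℂ} {m dm : ℝ} (hm : 0 < m) (hb : m ≤ b.re)
    (ha : ‖a‖ ≤ -dm) : ‖a / b‖ ≤ -dm / m := by
  rw [norm_div]
  exact div_le_div₀ ((norm_nonneg a).trans ha) ha hm (hb.trans (Complex.re_le_norm b))

/-! ### Powers of functions with positive real part -/

/-- Concavity of the cosine gives cos(ηx) ≥ η cos x + (1 - η), and weighted AM–GM bounds this below
by (cos x)^η. -/
theorem rpow_cos_le_cos_mul {x η : ℝ} (hx : 0 ≤ Real.cos x) (h1 : |x| ≤ Real.pi / 2) (hη0 : 0 ≤ η)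
    (hη1 : η ≤ 1) : Real.cos x ^ η ≤ Real.cos (x * η) := by
  have hx' := abs_le.mp h1
  have hc := strictConcaveOn_cos_Icc.concaveOn.2 (x := x) (y := 0) ⟨hx'.1, hx'.2⟩
    ⟨by linarith [Real.pi_pos], by linarith [Real.pi_pos]⟩ hη0 (sub_nonneg.mpr hη1) (by ring)
  simp only [smul_eq_mul, mul_zero, add_zero, Real.cos_zero] at hc
  have hg := Real.geom_mean_le_arith_mean2_weighted hη0 (sub_nonneg.mpr hη1) hx zero_le_one (by ring)
  rw [Real.one_rpow, mul_one] at hg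
  rw [mul_comm x η]
  exact hg.trans hc

theorem rpow_re_le_re_cpow {v : ℂ} (hv : 0 < v.re) {η : ℝ} (hη0 : 0 ≤ η) (hη1 : η ≤ 1) :
    v.re ^ η ≤ (v ^ (η : ℂ)).re := by
  have ha : |v.arg| ≤ Real.pi / 2 := Complex.abs_arg_le_pi_div_two_iff.mpr hv.le
  have hc : 0 ≤ Real.cos v.arg := Real.cos_nonneg_of_mem_Icc (abs_le.mp ha)
  have e : v.re = ‖v‖ * Real.cos v.arg := by
    rw [Complex.norm_mul_cos_arg]
  rw [Complex.cpow_ofReal_re, e, Real.mul_rpow (norm_nonneg v) hc]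
  exact mul_le_mul_of_nonneg_left (rpow_cos_le_cos_mul hc ha hη0 hη1)
    (Real.rpow_nonneg (norm_nonneg v) η)

theorem mem_slitPlane_of_re_pos {v : ℂ} (hv : 0 < v.re) : v ∈ slitPlane := Or.inl hv

theorem conj_cpow_ofReal {v : ℂ} (hv : 0 < v.re) (η : ℝ) :
    conj v ^ (η : ℂ) = conj (v ^ (η : ℂ)) := by
  have h := slitPlane_arg_ne_pi (mem_slitPlane_of_re_pos hv)
  rw [Complex.conj_cpow _ _ h, Complex.conj_ofReal]

/-- Raising to the power η multiplies the logarithmic derivative by η on both sides and, by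
`rpow_re_le_re_cpow`, preserves the minimality of the real part at -s. So it is enough to check the
base V. -/
theorem exists_isSharpRadius_cpow {V dV : ℂ → ℂ} {v dv q : ℝ → ℝ} {η : ℝ} (hη0 : 0 < η)
    (hη1 : η ≤ 1) (hV : ∀ w, ‖w‖ < 1 → HasDerivAt V (dV w) w)
    (hVre : ∀ w, ‖w‖ < 1 → 0 < (V w).re)
    (hconj : ∀ w, ‖w‖ < 1 → V (conj w) = conj (V w))
    (hreal : ∀ s ∈ Ico (0 : ℝ) 1, V (-(s : ℂ)) = (v s : ℂ))
    (hvc : ContinuousOn v (Icc 0 1)) (hvd : ∀ s ∈ Ico (0 : ℝ) 1, HasDerivAt v (dv s) s)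
    (hdv : ∀ s ∈ Ioo (0 : ℝ) 1, dv s ≤ 0) (hv0 : ∀ s ∈ Ico (0 : ℝ) 1, 0 < v s) (hv1 : 0 ≤ v 1)
    (hre : ∀ s ∈ Ico (0 : ℝ) 1, ∀ w, ‖w‖ ≤ s → v s ≤ (V w).re)
    (hlog : ∀ s ∈ Ico (0 : ℝ) 1, ∀ w : ℂ, ‖w‖ ≤ s → ‖dV w / V w‖ ≤ -dv s / v s)
    (hq : ∀ r ∈ Ioo (0 : ℝ) 1, q r = 0 ↔ (1 - r ^ 2) * v r ^ η = 2 * r) :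
    ∃ ρ : ℝ, IsSmallestRoot q ρ ∧ MajorizesDerivUpTo (starlikeConj fun w => V w ^ (η : ℂ)) ρ ∧
      (V 0 ^ (η : ℂ) = 1 → IsSharpRadius (starlikeConj fun w => V w ^ (η : ℂ)) ρ) := by
  have hz : (0 : ℝ) ∈ Ico (0 : ℝ) 1 := ⟨le_rfl, one_pos⟩
  refine exists_isSharpRadius_of_norm_logDeriv (ψ := fun w => V w ^ (η : ℂ))
    (dψ := fun w => η * V w ^ ((η : ℂ) - 1) * dV w) (m := fun s => v s ^ η)
    (dm := fun s => dv s * η * v s ^ (η - 1))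
    (fun w hw => (hV w hw).cpow_const (mem_slitPlane_of_re_pos (hVre w hw)))
    (fun w hw => ?_) (fun s hs => ?_) (hvc.rpow_const fun s _ => Or.inr hη0.le)
    (fun s hs => (hvd s hs).rpow_const (Or.inl (hv0 s hs).ne')) (fun s hs => ?_)
    (Real.rpow_pos_of_pos (hv0 0 hz) η) (Real.rpow_nonneg hv1 η) (fun s hs w hw => ?_)
    (fun s hs _ w hw => ?_) hq
  · simp only [hconj w hw]
    exact conj_cpow_ofReal (hVre w hw) η
  · simp only [hreal s hs]
    rw [Complex.ofReal_cpow (hv0 s hs).le]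
  · have h1 := Real.rpow_nonneg (hv0 s (Ioo_subset_Ico_self hs)).le (η - 1)
    exact mul_nonpos_of_nonpos_of_nonneg
      (mul_nonpos_of_nonpos_of_nonneg (hdv s hs) hη0.le) h1
  · have hs' : s ∈ Ico (0 : ℝ) 1 := ⟨hs.nonneg, hs.lt_one⟩
    exact (Real.rpow_le_rpow (hv0 s hs').le (hre s hs' w hw) hη0.le).trans
      (rpow_re_le_re_cpow (hVre w (hw.trans_lt hs.lt_one)) hη0.le hη1)
  · have hs' : s ∈ Ico (0 : ℝ) 1 := ⟨hs.nonneg, hs.lt_one⟩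
    have hVw : V w ≠ 0 := fun h => by
      have := hVre w (hw.trans_lt hs.lt_one)
      rw [h] at this
      exact lt_irrefl _ this
    have hVη : V w ^ (η : ℂ) ≠ 0 := by simp [Complex.cpow_eq_zero_iff, hVw]
    have e1 : η * V w ^ ((η : ℂ) - 1) * dV w / V w ^ (η : ℂ) = η * (dV w / V w) := by
      rw [Complex.cpow_sub _ _ hVw, Complex.cpow_one]
      field_simp
    have e2 : -(dv s * η * v s ^ (η - 1)) / v s ^ η = η * (-dv s / v s) := by
      have h1 := hv0 s hs'
      have h2 := Real.rpow_pos_of_pos h1 η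
      rw [Real.rpow_sub h1, Real.rpow_one]
      field_simp
    rw [e1, e2, norm_mul, Complex.norm_real, Real.norm_of_nonneg hη0.le]
    exact mul_le_mul_of_nonneg_left (hlog s hs' w hw) hη0.le

theorem one_add_mul_re_pos {E : ℝ} (hE : |E| ≤ 1) {w : ℂ} (hw : ‖w‖ < 1) :
    0 < (1 + E * w).re := by
  have h1 : |E * w.re| < 1 := by
    rw [abs_mul]
    have := (Complex.abs_re_le_norm w).trans_lt hw
    nlinarith [abs_nonneg E, abs_nonneg w.re]
  simp only [Complex.add_re, Complex.one_re, Complex.re_ofReal_mul]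
  linarith [(abs_lt.mp h1).1]

theorem ne_zero_of_re_pos {v : ℂ} (hv : 0 < v.re) : v ≠ 0 := fun h => by
  rw [h] at hv
  exact lt_irrefl _ hv

/-- On `|w| ≤ s` the real part of the Janowski function is smallest at `-s`. -/
theorem le_re_janowski {D E s : ℝ} (hE : |E| ≤ 1) (hED : E ≤ D) (hs0 : 0 ≤ s) (hs1 : s < 1)
    {w : ℂ} (hw : ‖w‖ ≤ s) : (1 - D * s) / (1 - E * s) ≤ ((1 + D * w) / (1 + E * w)).re := by
  have hn : 0 < Complex.normSq (1 + E * w) :=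
    Complex.normSq_pos.mpr (ne_zero_of_re_pos (one_add_mul_re_pos hE (hw.trans_lt hs1)))
  have hEs : 0 < 1 - E * s := by nlinarith [(abs_le.mp hE).2]
  have hx := abs_re_le_of_norm_le hw
  have hW := re_sq_add_im_sq_le hw
  rw [Complex.div_re, ← add_div, div_le_div_iff₀ hEs hn]
  simp only [Complex.normSq_apply, Complex.add_re, Complex.one_re, Complex.re_ofReal_mul,
    Complex.add_im, Complex.one_im, Complex.im_ofReal_mul]
  have h1 : 0 ≤ (s + w.re) - (w.re ^ 2 + w.im ^ 2 + s * w.re) := by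
    nlinarith
  have h2 : 0 ≤ (s + w.re) + (w.re ^ 2 + w.im ^ 2 + s * w.re) := by
    nlinarith [sq_nonneg w.im, mul_nonneg (by linarith : 0 ≤ s + w.re) (by linarith : 0 ≤ 1 + w.re)]
  -- The expression is affine in E; `h1` and `h2` are its values at E = -1 and E = 1.
  have h3 : 0 ≤ (s + w.re) + E * (w.re ^ 2 + w.im ^ 2 + s * w.re) := by
    nlinarith [(abs_le.mp hE).1, (abs_le.mp hE).2]
  nlinarith [mul_nonneg (sub_nonneg.mpr hED) h3]

/-- The base (1 + w)/(1 - w) has logarithmic derivative 2/(1 - w²), of modulus at most 2/(1 - s²),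
with equality at -s. -/
theorem sharpMajorization_psiStrong {η : ℝ} (hη0 : 0 < η) (hη1 : η ≤ 1) :
    SharpMajorization (psiStrong η)
      (fun r => (1 - r ^ 2) * ((1 - r) / (1 + r)) ^ η - 2 * r) := by
  have hne : ∀ w : ℂ, ‖w‖ < 1 → 1 - w ≠ 0 := fun w hw => by
    have := one_add_mul_re_pos (E := -1) (by norm_num) hw
    refine ne_zero_of_re_pos ?_
    simpa [sub_eq_add_neg] using this
  have hne' : ∀ w : ℂ, ‖w‖ < 1 → 1 + w ≠ 0 := fun w hw => by
    have := one_add_mul_re_pos (E := 1) (by norm_num) hw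
    refine ne_zero_of_re_pos ?_
    simpa using this
  have hre : ∀ s ∈ Ico (0 : ℝ) 1, ∀ w : ℂ, ‖w‖ ≤ s →
      (1 - s) / (1 + s) ≤ ((1 + w) / (1 - w)).re := fun s hs w hw => by
    simpa [sub_eq_add_neg] using
      le_re_janowski (D := 1) (E := -1) (by norm_num) (by norm_num) hs.1 hs.2 hw
  refine sharpMajorization_of_exists (by simp [psiStrong]) ?_
  refine exists_isSharpRadius_cpow (V := fun w => (1 + w) / (1 - w))
    (dV := fun w => 2 / (1 - w) ^ 2) (v := fun s => (1 - s) / (1 + s))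
    (dv := fun s => -2 / (1 + s) ^ 2)
    (q := fun r => (1 - r ^ 2) * ((1 - r) / (1 + r)) ^ η - 2 * r) hη0 hη1 ?_ ?_ ?_ ?_ ?_ ?_ ?_ ?_ ?_
    hre ?_ (fun r _ => sub_eq_zero)
  · intro w hw
    refine (((hasDerivAt_id w).const_add 1).div ((hasDerivAt_id w).const_sub 1)
      (hne w hw)).congr_deriv ?_
    simp only [id]
    congr 1
    ring
  · intro w hw
    refine lt_of_lt_of_le ?_ (hre ‖w‖ ⟨norm_nonneg w, hw⟩ w le_rfl)
    have := norm_nonneg w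
    exact div_pos (by linarith) (by linarith)
  · intro w _
    simp
  · intro s _
    push_cast
    ring
  · exact ContinuousOn.div (by fun_prop) (by fun_prop) fun s hs => by
      have := hs.1
      positivity
  · intro s hs
    have : 1 + s ≠ 0 := by linarith [hs.1]
    refine (((hasDerivAt_id s).const_sub 1).div ((hasDerivAt_id s).const_add 1)
      this).congr_deriv ?_
    simp only [id]
    congr 1
    ring
  · intro s _
    exact div_nonpos_of_nonpos_of_nonneg (by norm_num) (sq_nonneg _)
  · intro s hs
    exact div_pos (by linarith [hs.2]) (by linarith [hs.1])
  · norm_num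
  · intro s hs w hw
    have hw1 := hw.trans_lt hs.2
    have e1 : 2 / (1 - w) ^ 2 / ((1 + w) / (1 - w)) = 2 / (1 - w ^ 2) := by
      have h1 := hne w hw1
      have h2 := hne' w hw1
      have h3 : 1 - w ^ 2 ≠ 0 := by
        rw [show 1 - w ^ 2 = (1 - w) * (1 + w) by ring]
        exact mul_ne_zero h1 h2
      field_simp
      ring
    have h2 : 0 < 1 - s ^ 2 := by nlinarith [hs.1, hs.2]
    have e2 : - (-2 / (1 + s) ^ 2) / ((1 - s) / (1 + s)) = 2 / (1 - s ^ 2) := by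
      have h3 : 1 - s ≠ 0 := by linarith [hs.2]
      have h4 : 1 + s ≠ 0 := by linarith [hs.1]
      have h5 := h2.ne'
      field_simp
      ring
    rw [e1, e2, norm_div]
    have h6 : 1 - s ^ 2 ≤ ‖1 - w ^ 2‖ := by
      have := norm_sub_norm_le (1 : ℂ) (w ^ 2)
      rw [norm_one, norm_pow] at this
      nlinarith [norm_nonneg w]
    rw [Complex.norm_ofNat]
    gcongr

theorem exists_isSharpRadius_psiPower {a b : ℝ} (ha : 1 ≤ a) (hb : 0 < b) :
    ∃ ρ : ℝ, IsSmallestRoot (fun r => (1 - r ^ 2) * (b * (1 - r)) ^ (1 / a) - 2 * r) ρ ∧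
      MajorizesDerivUpTo (starlikeConj (psiPower a b)) ρ ∧
      (psiPower a b 0 = 1 → IsSharpRadius (starlikeConj (psiPower a b)) ρ) := by
  have ha0 : 0 < a := by linarith
  have e : psiPower a b = fun w : ℂ => ((b : ℂ) * (1 + w)) ^ ((1 / a : ℝ) : ℂ) := by
    funext w
    simp [psiPower]
  have hre : ∀ s ∈ Ico (0 : ℝ) 1, ∀ w : ℂ, ‖w‖ ≤ s → b * (1 - s) ≤ (b * (1 + w)).re :=
    fun s hs w hw => by
      rw [Complex.re_ofReal_mul, Complex.add_re, Complex.one_re]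
      have := (abs_re_le_of_norm_le hw).1
      gcongr
      linarith
  rw [e]
  refine exists_isSharpRadius_cpow (V := fun w => (b : ℂ) * (1 + w)) (dV := fun _ => (b : ℂ))
    (v := fun s => b * (1 - s)) (dv := fun s => -b) (by positivity)
    ((div_le_one ha0).mpr ha) ?_ ?_ ?_ ?_ (by fun_prop) ?_ ?_ ?_ (by simp) hre ?_
    (fun r _ => sub_eq_zero)
  · intro w _
    simpa using ((hasDerivAt_id w).const_add 1).const_mul (b : ℂ)
  · intro w hw
    refine lt_of_lt_of_le ?_ (hre ‖w‖ ⟨norm_nonneg w, hw⟩ w le_rfl)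
    exact mul_pos hb (by linarith)
  · intro w _
    simp
  · intro s _
    push_cast
    ring
  · intro s _
    simpa using ((hasDerivAt_id s).const_sub 1).const_mul b
  · intro s _
    linarith
  · intro s hs
    exact mul_pos hb (by linarith [hs.2])
  · intro s hs w hw
    have h1 := hre s hs w hw
    exact norm_div_le_neg_div (mul_pos hb (by linarith [hs.2])) h1
      (by rw [Complex.norm_real, Real.norm_of_nonneg hb.le, neg_neg])

/-! ### The exponential and the sigmoid -/

/-- Used with u = Re w + s: then u(2s - u) = s² - (Re w)² bounds (Im w)², and the product is a lower
bound for exp(u) cos(Im w). -/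
theorem one_sub_half_sq_mul_le {u s : ℝ} (hs : s < 5 / 12) (hu0 : 0 ≤ u) (hu1 : u ≤ 2 * s) :
    1 ≤ (1 + u) * (1 - u * (2 * s - u) / 2) := by
  have h1 : 0 ≤ u * (1 - s - u * s) := by
    apply mul_nonneg hu0
    nlinarith
  nlinarith [mul_nonneg hu0 hu0, mul_nonneg (mul_nonneg hu0 hu0) hu0]

/-- On `|w| ≤ s` the real part of `exp` is smallest at `-s`. -/
theorem exp_neg_le_re_exp {s : ℝ} (hs : s < 5 / 12) {w : ℂ} (hw : ‖w‖ ≤ s) :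
    Real.exp (-s) ≤ (exp w).re := by
  have hx := abs_re_le_of_norm_le hw
  have hW := re_sq_add_im_sq_le hw
  rw [Complex.exp_re]
  have h1 : 1 - w.im ^ 2 / 2 ≤ Real.cos w.im := Real.one_sub_sq_div_two_le_cos
  have h2 : w.re + s + 1 ≤ Real.exp (w.re + s) := Real.add_one_le_exp _
  have h3 : 1 ≤ (1 + (w.re + s)) * (1 - w.im ^ 2 / 2) := by
    refine (one_sub_half_sq_mul_le hs (u := w.re + s) (by linarith) (by linarith)).trans ?_
    apply mul_le_mul_of_nonneg_left _ (by linarith)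
    nlinarith
  have h4 : 0 ≤ 1 - w.im ^ 2 / 2 := by nlinarith [sq_nonneg w.re]
  have h5 : 1 ≤ Real.exp (w.re + s) * Real.cos w.im :=
    h3.trans (mul_le_mul (by linarith) h1 h4 (Real.exp_pos _).le)
  rw [Real.exp_add] at h5
  rw [Real.exp_neg, inv_le_iff_one_le_mul₀ (Real.exp_pos s)]
  linarith

theorem sharpMajorization_exp :
    SharpMajorization exp (fun r => (1 - r ^ 2) - 2 * r * Real.exp r) := by
  refine sharpMajorization_of_exists exp_zero ?_
  refine exists_isSharpRadius_of_norm_logDeriv (dψ := exp) (m := fun s => Real.exp (-s))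
    (dm := fun s => -Real.exp (-s)) (fun w _ => Complex.hasDerivAt_exp w)
    (fun w _ => Complex.exp_conj w) (fun s _ => by push_cast; rfl) (by fun_prop) (fun s _ => ?_)
    (fun s _ => neg_nonpos.mpr (Real.exp_pos _).le) (Real.exp_pos _) (Real.exp_pos _).le
    (fun s hs w hw => exp_neg_le_re_exp hs.lt_five_twelfths hw) (fun s _ hms w _ => ?_)
    (fun r _ => ?_)
  · simpa using (hasDerivAt_id s).neg.exp
  · rw [div_self (exp_ne_zero w), norm_one, neg_neg, div_self hms.ne']
  · have h := Real.exp_pos r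
    rw [Real.exp_neg, ← div_eq_mul_inv, div_eq_iff h.ne', sub_eq_zero]

theorem one_add_exp_neg_re_pos {w : ℂ} (hw : ‖w‖ < 1) : 0 < (1 + exp (-w)).re := by
  rw [Complex.add_re, Complex.one_re, Complex.exp_re]
  have h := abs_lt.mp ((Complex.abs_im_le_norm (-w)).trans_lt (by rwa [norm_neg]))
  have h2 := Real.cos_pos_of_mem_Ioo (x := (-w).im)
    ⟨by linarith [Real.pi_gt_three], by linarith [Real.pi_gt_three]⟩
  have := Real.exp_pos (-w).re
  positivity

theorem one_add_exp_neg_le_norm {s : ℝ} (hs : s < 5 / 12) {w : ℂ} (hw : ‖w‖ ≤ s) :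
    1 + Real.exp (-s) ≤ ‖1 + exp w‖ := by
  refine le_trans ?_ (Complex.re_le_norm _)
  rw [Complex.add_re, Complex.one_re]
  linarith [exp_neg_le_re_exp hs hw]

/-- Here ψ = 2 - 2/(1 + e^w) and ψ'/ψ = 1/(1 + e^w), so the single lower bound |1 + e^w| ≥ 1 +
e^(-s) controls both the real part and the logarithmic derivative. -/
theorem sharpMajorization_psiSigmoid :
    SharpMajorization psiSigmoid (fun r => (1 - r ^ 2) - r * (1 + Real.exp r)) := by
  have hpos : ∀ s : ℝ, 0 < 1 + Real.exp s := fun s => by positivity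
  refine sharpMajorization_of_exists (by norm_num [psiSigmoid]) ?_
  refine exists_isSharpRadius_of_norm_logDeriv (dψ := fun w => 2 * exp (-w) / (1 + exp (-w)) ^ 2)
    (m := fun s => 2 / (1 + Real.exp s)) (dm := fun s => -(2 * Real.exp s / (1 + Real.exp s) ^ 2))
    (fun w hw => ?_) (fun w _ => ?_) (fun s _ => ?_)
    (ContinuousOn.div (by fun_prop) (by fun_prop) fun s _ => (hpos s).ne') (fun s _ => ?_)
    (fun s _ => neg_nonpos.mpr (by positivity)) (by positivity) (by positivity)
    (fun s hs w hw => ?_) (fun s hs _ w hw => ?_) (fun r _ => ?_)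
  · have h := ne_zero_of_re_pos (one_add_exp_neg_re_pos hw)
    refine (((hasDerivAt_neg' w).cexp.const_add 1).fun_inv h |>.const_mul 2).congr_deriv ?_
    ring
  · simp [psiSigmoid, ← Complex.exp_conj, map_ofNat]
  · simp [psiSigmoid]
  · refine (((Real.hasDerivAt_exp s).const_add 1).fun_inv (hpos s).ne' |>.const_mul 2).congr_deriv ?_
    ring
  · have h1 := one_add_exp_neg_le_norm hs.lt_five_twelfths hw
    have h2 := ne_zero_of_re_pos (one_add_exp_neg_re_pos (hw.trans_lt hs.lt_one))
    have h3 : 0 < ‖1 + exp w‖ := (hpos (-s)).trans_le h1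
    have h4 := norm_pos_iff.mp h3
    have e : psiSigmoid w = 2 - 2 / (1 + exp w) := by
      rw [Complex.exp_neg] at h2
      rw [psiSigmoid, Complex.exp_neg]
      have := exp_ne_zero w
      have h5 : exp w + 1 ≠ 0 := by rwa [add_comm]
      field_simp
      ring
    have h6 : (2 / (1 + exp w)).re ≤ 2 / (1 + Real.exp (-s)) := by
      refine (Complex.re_le_norm _).trans ?_
      rw [norm_div, Complex.norm_ofNat]
      gcongr
    have h7 : 2 / (1 + Real.exp s) = 2 - 2 / (1 + Real.exp (-s)) := by
      rw [Real.exp_neg]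
      have := Real.exp_pos s
      field_simp
      ring
    rw [e, h7, Complex.sub_re]
    have : (2 : ℂ).re = 2 := rfl
    linarith
  · have h1 := one_add_exp_neg_le_norm hs.lt_five_twelfths hw
    have h2 := ne_zero_of_re_pos (one_add_exp_neg_re_pos (hw.trans_lt hs.lt_one))
    have h4 := norm_pos_iff.mp ((hpos (-s)).trans_le h1)
    have e : 2 * exp (-w) / (1 + exp (-w)) ^ 2 / psiSigmoid w = 1 / (1 + exp w) := by
      rw [psiSigmoid]
      rw [Complex.exp_neg] at h2 ⊢
      have := exp_ne_zero w
      have h5 : exp w + 1 ≠ 0 := by rwa [add_comm]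
      field_simp
      ring
    have e2 : - -(2 * Real.exp s / (1 + Real.exp s) ^ 2) / (2 / (1 + Real.exp s))
        = 1 / (1 + Real.exp (-s)) := by
      rw [Real.exp_neg]
      have := Real.exp_pos s
      field_simp
      ring
    rw [e, e2, norm_div, norm_one]
    have := hpos (-s)
    gcongr
  · have := hpos r
    rw [← mul_div_assoc, div_eq_iff this.ne', sub_eq_zero]
    constructor <;> intro h <;> linarith

/-! ### The function 1 + sin z -/

theorem half_sub_le_sin_sub_sin {a s : ℝ} (ha : 0 ≤ a) (has : a ≤ s) (hs : s < 5 / 12) :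
    (s - a) / 2 ≤ Real.sin s - Real.sin a := by
  have h := Convex.mul_sub_le_image_sub_of_le_deriv (convex_Icc a s) (f := Real.sin) (C := 1 / 2)
    Real.continuous_sin.continuousOn Real.differentiable_sin.differentiableOn (fun x hx => by
      rw [interior_Icc] at hx
      rw [Real.deriv_sin]
      have : 1 - x ^ 2 / 2 ≤ Real.cos x := Real.one_sub_sq_div_two_le_cos
      nlinarith [hx.1, hx.2]) a (left_mem_Icc.mpr has) s (right_mem_Icc.mpr has) has
  linarith

/-- The chain is cosh y ≤ exp(y²/2) ≤ 1/(1 - y²/2) ≤ 1 + y². -/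
theorem cosh_le_one_add_sq {y : ℝ} (hy : y ^ 2 ≤ 1) : Real.cosh y ≤ 1 + y ^ 2 := by
  refine (Real.cosh_le_exp_half_sq y).trans ?_
  have h := Real.exp_bound_div_one_sub_of_interval (x := y ^ 2 / 2) (by positivity) (by linarith)
  refine h.trans ?_
  rw [div_le_iff₀ (by linarith)]
  nlinarith [sq_nonneg y]

/-- On `|w| ≤ s` the real part of `sin` is smallest at `-s`. -/
theorem neg_sin_le_re_sin {s : ℝ} (hs : s < 5 / 12) {w : ℂ} (hw : ‖w‖ ≤ s) :
    -Real.sin s ≤ Real.sin w.re * Real.cosh w.im := by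
  have hx := abs_re_le_of_norm_le hw
  have hW := re_sq_add_im_sq_le hw
  have hs0 : 0 ≤ s := (norm_nonneg w).trans hw
  have hpi := Real.pi_gt_three
  rcases le_total 0 w.re with h | h
  · have h1 := Real.sin_nonneg_of_nonneg_of_le_pi h (by linarith)
    have h2 := Real.sin_nonneg_of_nonneg_of_le_pi hs0 (by linarith)
    have := mul_nonneg h1 (Real.cosh_pos w.im).le
    linarith
  · set a := -w.re with ha
    have ha0 : 0 ≤ a := by linarith
    have e : w.re = -a := by rw [ha, neg_neg]
    rw [e, Real.sin_neg]
    rw [e] at hW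
    have h1 := Real.sin_nonneg_of_nonneg_of_le_pi ha0 (by linarith)
    have h2 := half_sub_le_sin_sub_sin ha0 (by linarith : a ≤ s) hs
    have h3 : Real.cosh w.im ≤ 1 + (s ^ 2 - a ^ 2) :=
      (cosh_le_one_add_sq (by nlinarith)).trans (by linarith)
    have h4 : Real.sin a ≤ a := Real.sin_le ha0
    have h5 : Real.sin a * (Real.cosh w.im - 1) ≤ a * (s ^ 2 - a ^ 2) :=
      mul_le_mul h4 (by linarith) (by linarith [Real.one_le_cosh w.im]) ha0
    have h6 : a * (s ^ 2 - a ^ 2) ≤ (s - a) / 2 := by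
      have h7 : a * (s + a) ≤ 1 / 2 := by nlinarith
      nlinarith [mul_nonneg (sub_nonneg.mpr h7) (by linarith : 0 ≤ s - a)]
    linarith

/-- Put σ = sin(Re w), C = cosh(Im w), S = sin s. Then |1 + sin w|² = (C + σ)² and |cos w|² = (C -
σ)(C + σ), so the bound on |ψ'/ψ| is (C - σ)/(C + σ) ≤ (1 + S)/(1 - S). This amounts to σ + SC ≥ 0,
which holds because σ ≥ -S and C ≥ 1. -/
theorem sharpMajorization_one_add_sin :
    SharpMajorization (fun z => 1 + sin z)
      (fun r => (1 - r ^ 2) * (1 - Real.sin r) - 2 * r) := by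
  have hpi := Real.pi_gt_three
  have hre : ∀ w : ℂ, (1 + sin w).re = 1 + Real.sin w.re * Real.cosh w.im := fun w => by
    rw [Complex.add_re, Complex.one_re, Complex.sin_eq]
    simp [← Complex.ofReal_sin, ← Complex.ofReal_cos, ← Complex.ofReal_cosh,
      ← Complex.ofReal_sinh]
  refine sharpMajorization_of_exists (by simp) ?_
  refine exists_isSharpRadius_of_norm_logDeriv (dψ := cos) (m := fun s => 1 - Real.sin s)
    (dm := fun s => -Real.cos s) (fun w _ => (Complex.hasDerivAt_sin w).const_add 1)
    (fun w _ => by simp [Complex.sin_conj]) (fun s _ => by simp [sub_eq_add_neg]) (by fun_prop)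
    (fun s _ => (Real.hasDerivAt_sin s).const_sub 1) (fun s hs => ?_) (by simp)
    (by linarith [Real.sin_le_one 1]) (fun s hs w hw => ?_) (fun s hs hms w hw => ?_)
    (fun r _ => sub_eq_zero)
  · exact neg_nonpos.mpr (Real.cos_nonneg_of_mem_Icc
      ⟨by linarith [hs.1], by linarith [hs.2]⟩)
  · rw [hre]
    linarith [neg_sin_le_re_sin hs.lt_five_twelfths hw]
  · have hs5 := hs.lt_five_twelfths
    have hx := abs_re_le_of_norm_le hw
    have hre1 : 1 - Real.sin s ≤ (1 + sin w).re := by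
      rw [hre]
      linarith [neg_sin_le_re_sin hs5 hw]
    have hσ : -Real.sin s ≤ Real.sin w.re := by
      rw [← Real.sin_neg]
      exact Real.sin_le_sin_of_le_of_le_pi_div_two (by linarith) (by linarith) hx.1
    have hn : ‖1 + sin w‖ ^ 2 = (Real.sin w.re + Real.cosh w.im) ^ 2 := by
      rw [Complex.sq_norm, Complex.normSq_apply, hre, Complex.sin_eq]
      simp [← Complex.ofReal_sin, ← Complex.ofReal_cos, ← Complex.ofReal_cosh,
        ← Complex.ofReal_sinh]
      have h1 := Real.sin_sq_add_cos_sq w.re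
      have h2 := Real.cosh_sq w.im
      linear_combination (Real.sinh w.im) ^ 2 * h1 + (Real.sin w.re ^ 2 - 1) * h2
    have hc : ‖cos w‖ ^ 2 = Real.cosh w.im ^ 2 - Real.sin w.re ^ 2 := by
      rw [Complex.sq_norm, Complex.normSq_apply, Complex.cos_eq]
      simp [← Complex.ofReal_sin, ← Complex.ofReal_cos, ← Complex.ofReal_cosh,
        ← Complex.ofReal_sinh]
      have h1 := Real.sin_sq_add_cos_sq w.re
      have h2 := Real.cosh_sq w.im
      linear_combination (Real.cosh w.im) ^ 2 * h1 - (Real.sin w.re ^ 2) * h2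
    have hS1 : Real.sin s < 1 := by linarith
    have hcosh := Real.one_le_cosh w.im
    have hS0 := Real.sin_nonneg_of_nonneg_of_le_pi hs.nonneg (by linarith)
    have hcs := Real.cos_sq' s
    have hcs0 : 0 ≤ Real.cos s := Real.cos_nonneg_of_mem_Icc
      ⟨by linarith [hs.nonneg], by linarith⟩
    have hnpos : 0 < ‖1 + sin w‖ := hms.trans_le (hre1.trans (Complex.re_le_norm _))
    rw [norm_div, neg_neg, div_le_div_iff₀ hnpos hms]
    refine (sq_le_sq₀ (by positivity) (by positivity)).mp ?_
    rw [mul_pow, mul_pow, hn, hc, hcs]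
    have h1 : 0 ≤ Real.sin w.re + Real.cosh w.im := by linarith
    have h2 : 0 ≤ Real.sin w.re + Real.sin s * Real.cosh w.im := by nlinarith
    nlinarith [mul_nonneg (mul_nonneg h1 h2) hms.le]

/-! ### Principal square roots and the function z + √(1 + z²) -/

/-- The principal square root of a function with values in the right half-plane. -/
theorem hasDerivAt_csqrt {V : ℂ → ℂ} {V' w : ℂ} (hV : HasDerivAt V V' w) (h : 0 < (V w).re) :
    HasDerivAt (fun u => V u ^ (1 / 2 : ℂ)) (V' / (2 * V w ^ (1 / 2 : ℂ))) w := by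
  refine (hV.cpow_const (c := 1 / 2) (mem_slitPlane_of_re_pos h)).congr_deriv ?_
  have h0 := ne_zero_of_re_pos h
  have h1 : V w ^ (1 / 2 : ℂ) ≠ 0 := by simp [Complex.cpow_eq_zero_iff, h0]
  have e : V w ^ (1 / 2 - 1 : ℂ) = (V w ^ (1 / 2 : ℂ))⁻¹ := by
    rw [← Complex.cpow_neg]
    norm_num
  rw [e]
  field_simp

theorem csqrt_sq (v : ℂ) : (v ^ (1 / 2 : ℂ)) ^ 2 = v := by
  rw [← Complex.cpow_nat_mul]
  norm_num

theorem norm_csqrt (v : ℂ) : ‖v ^ (1 / 2 : ℂ)‖ = √‖v‖ := by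
  rw [eq_comm, Real.sqrt_eq_iff_mul_self_eq (norm_nonneg _) (norm_nonneg _), ← norm_mul, ← sq,
    csqrt_sq]

theorem conj_csqrt {v : ℂ} (h : 0 < v.re) : conj v ^ (1 / 2 : ℂ) = conj (v ^ (1 / 2 : ℂ)) := by
  simpa using conj_cpow_ofReal h (1 / 2)

theorem ofReal_csqrt {x : ℝ} (hx : 0 ≤ x) : (x : ℂ) ^ (1 / 2 : ℂ) = (√x : ℝ) := by
  rw [Real.sqrt_eq_rpow, Complex.ofReal_cpow hx]
  norm_num

theorem sqrt_re_le_re_csqrt {v : ℂ} (h : 0 < v.re) : √v.re ≤ (v ^ (1 / 2 : ℂ)).re := by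
  have := rpow_re_le_re_cpow h (η := 1 / 2) (by norm_num) (by norm_num)
  rw [Real.sqrt_eq_rpow]
  simpa using this

theorem one_add_sq_re_pos {w : ℂ} (hw : ‖w‖ < 1) : 0 < (1 + w ^ 2).re := by
  have h1 := re_sq_add_im_sq_le (w := w) le_rfl
  rw [sq w, Complex.add_re, Complex.one_re, Complex.mul_re]
  nlinarith [norm_nonneg w, sq_nonneg w.re]

theorem one_le_sqrt_one_add_sq (s : ℝ) : 1 ≤ √(1 + s ^ 2) :=
  Real.one_le_sqrt.mpr (by nlinarith [sq_nonneg s])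

/-- On `|w| ≤ s` the real part of `w + √(1 + w²)` is smallest at `-s`. -/
theorem le_re_psiCrescent {s : ℝ} (hs : s < 1 / 3) {w : ℂ} (hw : ‖w‖ ≤ s) :
    √(1 + s ^ 2) - s ≤ (psiCrescent w).re := by
  have hx := abs_re_le_of_norm_le hw
  have hW := re_sq_add_im_sq_le hw
  have hs0 : 0 ≤ s := (norm_nonneg w).trans hw
  have h1 := sqrt_re_le_re_csqrt (one_add_sq_re_pos (hw.trans_lt (by linarith)))
  have h2 : √(1 + 2 * w.re ^ 2 - s ^ 2) ≤ √(1 + w ^ 2).re := by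
    apply Real.sqrt_le_sqrt
    rw [sq w, Complex.add_re, Complex.one_re, Complex.mul_re]
    linarith
  set r := √(1 + 2 * w.re ^ 2 - s ^ 2) with hr
  have h0 : 0 ≤ 1 + 2 * w.re ^ 2 - s ^ 2 := by nlinarith [sq_nonneg w.re]
  have hr2 : r ^ 2 = 1 + 2 * w.re ^ 2 - s ^ 2 := Real.sq_sqrt h0
  have hr1 : 2 / 3 ≤ r := Real.le_sqrt_of_sq_le (by nlinarith [sq_nonneg w.re])
  have h3 : √(1 + s ^ 2) ≤ (s + w.re) + r := by
    apply Real.sqrt_le_iff.mpr ⟨by linarith, ?_⟩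
    nlinarith [mul_nonneg (by linarith : 0 ≤ s + w.re) (by linarith : 0 ≤ 2 * r - (s - 3 * w.re))]
  rw [psiCrescent, Complex.add_re]
  linarith

/-- The left side of the hypothesis is 2(Re T)². This removes the square root from estimates of Re T
when T² is explicit. -/
theorem re_le_norm_of_sq {T : ℂ} {τ : ℝ} (hτ : 0 ≤ τ)
    (h : ‖T ^ 2‖ + (T ^ 2).re ≤ 2 * τ ^ 2) : -τ ≤ T.re := by
  rw [norm_pow, Complex.sq_norm, Complex.normSq_apply, sq T, Complex.mul_re] at h
  nlinarith [sq_nonneg (T.re + τ)]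

theorem neg_div_sqrt_le_re {w : ℂ} (hw : ‖w‖ ≤ 1 / 2) :
    -(‖w‖ / √(1 + ‖w‖ ^ 2)) ≤ (w / (1 + w ^ 2) ^ (1 / 2 : ℂ)).re := by
  set X := ‖w‖ with hX
  have hX0 : 0 ≤ X := norm_nonneg w
  apply re_le_norm_of_sq (by positivity)
  rw [div_pow, div_pow, csqrt_sq, Real.sq_sqrt (by positivity)]
  set u := w ^ 2 with hu
  have hun : ‖u‖ = X ^ 2 := norm_pow w 2
  have hure := Complex.re_le_norm u
  have hsq : u.re ^ 2 + u.im ^ 2 = X ^ 4 := by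
    have : u.re ^ 2 + u.im ^ 2 = ‖u‖ ^ 2 := by
      rw [Complex.sq_norm, Complex.normSq_apply]
      ring
    rw [this, hun]
    ring
  set N := ‖1 + u‖ with hN
  have hN2 : N ^ 2 = (1 + X ^ 2) ^ 2 - 2 * (X ^ 2 - u.re) := by
    rw [hN, Complex.sq_norm, Complex.normSq_apply]
    simp only [Complex.add_re, Complex.one_re, Complex.add_im, Complex.one_im]
    linear_combination hsq
  have hNpos : 0 < N := norm_pos_iff.mpr (ne_zero_of_re_pos (one_add_sq_re_pos (by linarith)))
  have e : (u / (1 + u)).re = (u.re + X ^ 4) / N ^ 2 := by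
    rw [Complex.div_re, ← Complex.normSq_eq_norm_sq]
    simp only [Complex.add_re, Complex.one_re, Complex.add_im, Complex.one_im]
    rw [← hsq]
    ring
  rw [norm_div, hun, e]
  have hd : 0 ≤ X ^ 2 - u.re := by linarith
  -- AM–GM in the form 2N(1 + X²) ≤ N² + (1 + X²)², combined with `hN2`; it eliminates the modulus N
  -- linearly.
  have hNle : N * (1 + X ^ 2) ≤ (1 + X ^ 2) ^ 2 - (X ^ 2 - u.re) := by
    nlinarith [sq_nonneg (N - (1 + X ^ 2))]
  have e2 : X ^ 2 / N + (u.re + X ^ 4) / N ^ 2 = (X ^ 2 * N + u.re + X ^ 4) / N ^ 2 := by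
    field_simp
    ring
  rw [e2, ← mul_div_assoc, div_le_div_iff₀ (by positivity) (by positivity)]
  rw [hN2]
  have hX2 : X ^ 2 ≤ 1 / 4 := by nlinarith
  nlinarith [mul_le_mul_of_nonneg_left hNle (sq_nonneg X), mul_nonneg hd (sq_nonneg X),
    mul_nonneg (mul_nonneg hd (sq_nonneg X)) (sq_nonneg X)]

/-- With a and b the values of x/√(1 + x²) at X and s, b² - a² = (s² - X²)/((1 + s²)(1 + X²)), and a
+ b ≤ s + X turns this into a lower bound for b - a. The constant 47/50 lies below √(8/9), the least
possible √(1 - X²) for X ≤ 1/3. -/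
theorem div_sqrt_add_le {X s : ℝ} (hX : 0 ≤ X) (hXs : X ≤ s) (hs : s < 1 / 3) :
    X / √(1 + X ^ 2) + (s ^ 2 - X ^ 2) / (1 - s ^ 2) / √(1 - X ^ 2) ≤ s / √(1 + s ^ 2) := by
  have hs0 : 0 ≤ s := hX.trans hXs
  set a := X / √(1 + X ^ 2) with ha
  set b := s / √(1 + s ^ 2) with hb
  have hX2 : X ^ 2 ≤ s ^ 2 := by gcongr
  have hs2 : s ^ 2 ≤ 1 / 9 := by nlinarith
  have ha2 : a ^ 2 = X ^ 2 / (1 + X ^ 2) := by rw [ha, div_pow, Real.sq_sqrt (by positivity)]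
  have hb2 : b ^ 2 = s ^ 2 / (1 + s ^ 2) := by rw [hb, div_pow, Real.sq_sqrt (by positivity)]
  have ha0 : 0 ≤ a := by positivity
  have hb0 : 0 ≤ b := by positivity
  have haX : a ≤ X := div_le_self hX (one_le_sqrt_one_add_sq X)
  have hbs : b ≤ s := div_le_self hs0 (one_le_sqrt_one_add_sq s)
  have hr : 47 / 50 ≤ √(1 - X ^ 2) := Real.le_sqrt_of_sq_le (by linarith)
  have h1s : 0 < 1 - s ^ 2 := by linarith
  have h1 : (s ^ 2 - X ^ 2) / (1 - s ^ 2) / √(1 - X ^ 2)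
      ≤ (s ^ 2 - X ^ 2) / (1 - s ^ 2) / (47 / 50) :=
    div_le_div_of_nonneg_left (div_nonneg (by linarith) h1s.le) (by norm_num) hr
  have h2 : (b - a) * (b + a) * ((1 + s ^ 2) * (1 + X ^ 2)) = (s - X) * (s + X) := by
    rw [show (b - a) * (b + a) = b ^ 2 - a ^ 2 by ring, ha2, hb2]
    field_simp
    ring
  have h3 : (s ^ 2 - X ^ 2) / (1 - s ^ 2) / (47 / 50) ≤ b - a := by
    rcases hXs.eq_or_lt with h | h
    · have : a = b := by rw [ha, hb, h]
      rw [h, this]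
      simp
    · have hsX : 0 < s + X := by linarith
      have h4 : (1 + s ^ 2) * (1 + X ^ 2) * (s + X) ≤ (1 - s ^ 2) * (47 / 50) := by
        have h5 : (1 + s ^ 2) * (1 + X ^ 2) ≤ 100 / 81 := by nlinarith [sq_nonneg X, sq_nonneg s]
        have h6 : (1 + s ^ 2) * (1 + X ^ 2) * (s + X) ≤ 100 / 81 * (2 / 3) := by
          apply mul_le_mul h5 (by linarith) hsX.le (by norm_num)
        nlinarith
      have hba : 0 ≤ b - a := by
        by_contra! hneg
        have h7 : (b - a) * (b + a) * ((1 + s ^ 2) * (1 + X ^ 2)) ≤ 0 := by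
          apply mul_nonpos_of_nonpos_of_nonneg _ (by positivity)
          exact mul_nonpos_of_nonpos_of_nonneg hneg.le (by positivity)
        have := mul_pos (sub_pos.mpr h) hsX
        linarith
      have h8 : s - X ≤ (b - a) * ((1 + s ^ 2) * (1 + X ^ 2)) := by
        have h9 : (s - X) * (s + X) ≤ (b - a) * ((1 + s ^ 2) * (1 + X ^ 2)) * (s + X) := by
          rw [← h2]
          have : (b - a) * (b + a) ≤ (b - a) * (s + X) :=
            mul_le_mul_of_nonneg_left (by linarith) hba
          nlinarith [mul_le_mul_of_nonneg_right this
            (by positivity : 0 ≤ (1 + s ^ 2) * (1 + X ^ 2))]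
        exact le_of_mul_le_mul_right h9 hsX
      rw [div_div, div_le_iff₀ (by positivity)]
      have h10 := mul_le_mul_of_nonneg_left h4 hba
      have h11 := mul_le_mul_of_nonneg_right h8 hsX.le
      nlinarith
  linarith

/-- Here ψ'/ψ = 1/√(1 + w²), whose modulus is largest on the imaginary axis rather than at -s, so
the real part of (w + ζ)/√(1 + w²) is estimated instead. Admissibility forces s < 1/3, where these
estimates hold. -/
theorem sharpMajorization_psiCrescent :
    SharpMajorization psiCrescent (fun r => (1 - r ^ 2) * (√(1 + r ^ 2) - r) - 2 * r) := by
  have hpos : ∀ s : ℝ, 0 < 1 + s ^ 2 := fun s => by positivity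
  have hsq : ∀ s : ℝ, 0 < √(1 + s ^ 2) := fun s => Real.sqrt_pos.mpr (hpos s)
  have hmpos : ∀ s : ℝ, 0 < √(1 + s ^ 2) - s := fun s => by
    rw [sub_pos]
    exact Real.lt_sqrt_of_sq_lt (by linarith)
  have hthird : ∀ s, Admissible (fun s => √(1 + s ^ 2) - s) s → s < 1 / 3 := fun s hs => by
    have h1 := hs.le_mul
    have h5 := hs.lt_five_twelfths
    have h0 := hs.nonneg
    have h2 : √(1 + s ^ 2) ≤ 1 + s ^ 2 / 2 :=
      Real.sqrt_le_iff.mpr ⟨by positivity, by nlinarith [sq_nonneg (s ^ 2)]⟩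
    have h3 : 0 ≤ 1 - s ^ 2 := by nlinarith
    have h4 := mul_le_mul_of_nonneg_left h2 h3
    by_contra! h
    nlinarith [mul_nonneg (sub_nonneg.mpr h) h0, mul_nonneg (sub_nonneg.mpr h) (sq_nonneg s)]
  refine sharpMajorization_of_exists (by simp [psiCrescent]) ?_
  refine exists_isSharpRadius_of_logDeriv
    (dψ := fun w => 1 + w / (1 + w ^ 2) ^ (1 / 2 : ℂ)) (m := fun s => √(1 + s ^ 2) - s)
    (dm := fun s => s / √(1 + s ^ 2) - 1) (fun w hw => ?_) (fun w hw => ?_) (fun s _ => ?_)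
    (by fun_prop) (fun s _ => ?_) (fun s _ => ?_) (hmpos 0) (hmpos 1).le
    (fun s hs w hw => le_re_psiCrescent (hthird s hs) hw) (fun s hs hms w ζ hw hζ => ?_)
    (fun r _ => sub_eq_zero)
  · have h1 := hasDerivAt_csqrt (V := fun u => 1 + u ^ 2) ((hasDerivAt_pow 2 w).const_add 1)
      (one_add_sq_re_pos hw)
    refine ((hasDerivAt_id w).add h1).congr_deriv ?_
    simp only [Nat.cast_ofNat, Nat.add_one_sub_one, pow_one]
    rw [mul_div_mul_left _ _ two_ne_zero]
  · have h := conj_csqrt (one_add_sq_re_pos hw)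
    simp only [map_add, map_one, map_pow] at h
    simp only [psiCrescent, map_add, h]
  · have h := ofReal_csqrt (hpos s).le
    push_cast at h
    simp only [psiCrescent, neg_sq, h]
    push_cast
    ring
  · have h1 : HasDerivAt (fun x : ℝ => √(1 + x ^ 2)) (2 * s / (2 * √(1 + s ^ 2))) s := by
      simpa using ((hasDerivAt_pow 2 s).const_add 1).sqrt (hpos s).ne'
    rw [mul_div_mul_left _ _ two_ne_zero] at h1
    exact h1.sub (hasDerivAt_id s)
  · rw [sub_nonpos, div_le_one (hsq s)]
    linarith [hmpos s]
  · have hs3 := hthird s hs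
    have hw1 : ‖w‖ < 1 := hw.trans_lt hs.lt_one
    have hψ0 : psiCrescent w ≠ 0 :=
      ne_zero_of_re_pos (hms.trans_le (le_re_psiCrescent hs3 hw))
    have hS2 := csqrt_sq (1 + w ^ 2)
    have hSn := norm_csqrt (1 + w ^ 2)
    have h1w := ne_zero_of_re_pos (one_add_sq_re_pos hw1)
    have hre := neg_div_sqrt_le_re (w := w) (by linarith)
    have hψ : psiCrescent w = w + (1 + w ^ 2) ^ (1 / 2 : ℂ) := rfl
    set S := (1 + w ^ 2) ^ (1 / 2 : ℂ) with hS
    have hS0 : S ≠ 0 := fun h => h1w (by rw [← hS2, h]; ring)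
    have e : (w + ζ) * ((1 + w / S) / psiCrescent w) = w / S + ζ / S := by
      rw [hψ] at hψ0 ⊢
      field_simp
      ring
    have e2 : s * (s / √(1 + s ^ 2) - 1) / (√(1 + s ^ 2) - s) = -(s / √(1 + s ^ 2)) := by
      have h1 := (hmpos s).ne'
      have h2 := (hsq s).ne'
      field_simp
      ring
    rw [e, e2, Complex.add_re]
    have h1 : ‖ζ / S‖ ≤ (s ^ 2 - ‖w‖ ^ 2) / (1 - s ^ 2) / √(1 - ‖w‖ ^ 2) := by
      rw [norm_div, hSn]
      have h2 : 1 - ‖w‖ ^ 2 ≤ ‖1 + w ^ 2‖ := by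
        have := norm_sub_le (1 + w ^ 2) (w ^ 2)
        rw [add_sub_cancel_right, norm_one, norm_pow] at this
        linarith
      have h3 : 0 < 1 - ‖w‖ ^ 2 := by nlinarith [norm_nonneg w]
      exact div_le_div₀ ((norm_nonneg ζ).trans hζ) hζ (Real.sqrt_pos.mpr h3) (Real.sqrt_le_sqrt h2)
    have h2 := (abs_le.mp ((Complex.abs_re_le_norm (ζ / S)).trans h1)).1
    have h3 := div_sqrt_add_le (norm_nonneg w) hw hs3
    linarith

/-! ### The function with √2 and the quotient (1 - z)/(1 + 2(√2 - 1)z) -/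

/-- On |w| = t, with y = t + Re w, the right side is |1 - w|²|1 + pw|⁴. Its excess over the value at
y = 0 is 2y times a concave quadratic in y, so that quadratic need only be checked at y = 0 (`e0`)
and y = 2t (`e1`). -/
theorem one_add_mul_sq_le_aux {p t y : ℝ} (hp0 : 4 / 5 ≤ p) (hp1 : p ≤ 5 / 6) (ht0 : 0 ≤ t)
    (ht1 : t ≤ 5 / 12) (hy0 : 0 ≤ y) (hy1 : y ≤ 2 * t) :
    (1 + t) ^ 2 * (1 - p * t) ^ 4
      ≤ ((1 + t) ^ 2 - 2 * y) * ((1 - p * t) ^ 2 + 2 * p * y) ^ 2 := by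
  set A := (1 + t) ^ 2 with hA
  set B := (1 - p * t) ^ 2 with hB
  have hpt : 0 ≤ p * t := by positivity
  have hpt1 : p * t ≤ 5 / 6 * t := by gcongr
  have hB1 : B ≤ 1 := by nlinarith
  have hB0 : 0 ≤ B := sq_nonneg _
  have hA1 : 1 ≤ A := by nlinarith
  have hBt : B ≤ 2 * p * (1 - t) ^ 2 := by
    have h1 : B ≤ (1 - 4 / 5 * t) ^ 2 := by
      rw [hB]
      apply pow_le_pow_left₀ (by nlinarith)
      nlinarith
    have h2 : (1 - 4 / 5 * t) ^ 2 ≤ 8 / 5 * (1 - t) ^ 2 := by nlinarith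
    nlinarith [sq_nonneg (1 - t)]
  have e0 : 0 ≤ 2 * p * A * B - B ^ 2 := by
    have : B ≤ 2 * p * A := by nlinarith
    nlinarith [mul_nonneg hB0 (sub_nonneg.mpr this)]
  have e1 : 0 ≤ 2 * p * A * B - B ^ 2 + 4 * p ^ 2 * A * t - 8 * p * B * t - 16 * p ^ 2 * t ^ 2 := by
    have h : 2 * p * A * B - B ^ 2 + 4 * p ^ 2 * A * t - 8 * p * B * t - 16 * p ^ 2 * t ^ 2
        = B * (2 * p * (1 - t) ^ 2 - B) + 4 * p ^ 2 * t * (1 - t) ^ 2 := by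
      rw [hA]
      ring
    rw [h]
    have := mul_nonneg hB0 (sub_nonneg.mpr hBt)
    positivity
  rcases ht0.eq_or_lt with h | h
  · have : y = 0 := by linarith
    rw [this, hB]
    nlinarith
  have e2 : 0 ≤ 2 * p * A * B - B ^ 2 + 2 * p ^ 2 * A * y - 4 * p * B * y - 4 * p ^ 2 * y ^ 2 := by
    have h1 := mul_nonneg e0 (sub_nonneg.mpr hy1)
    have h2 := mul_nonneg e1 hy0
    have h3 := mul_nonneg (mul_nonneg (sq_nonneg p) h.le) (mul_nonneg hy0 (sub_nonneg.mpr hy1))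
    have h4 : 0 ≤ 2 * t * (2 * p * A * B - B ^ 2 + 2 * p ^ 2 * A * y - 4 * p * B * y
        - 4 * p ^ 2 * y ^ 2) := by
      nlinarith
    exact nonneg_of_mul_nonneg_right h4 (by positivity)
  have e3 : (A - 2 * y) * (B + 2 * p * y) ^ 2 - A * B ^ 2
      = 2 * y * (2 * p * A * B - B ^ 2 + 2 * p ^ 2 * A * y - 4 * p * B * y - 4 * p ^ 2 * y ^ 2) := by
    ring
  have e4 : (1 - p * t) ^ 4 = B ^ 2 := by
    rw [hB]
    ring
  rw [e4]
  linarith [mul_nonneg (mul_nonneg two_pos.le hy0) e2]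

theorem one_add_mul_sq_anti {p t s : ℝ} (hp0 : 4 / 5 ≤ p) (hp1 : p ≤ 5 / 6) (ht0 : 0 ≤ t)
    (hts : t ≤ s) (hs : s ≤ 5 / 12) : (1 + s) * (1 - p * s) ^ 2 ≤ (1 + t) * (1 - p * t) ^ 2 := by
  have hs0 : 0 ≤ s := ht0.trans hts
  have h1 : p * t ≤ p * s := by gcongr
  have h2 : p * s ≤ 5 / 6 * s := by gcongr
  have h4 : 0 ≤ (1 - p * t) ^ 2 * (1 + t) - (1 - p * s) ^ 2 * (1 + s)
      - (s - t) * (p * ((1 - p * t) + (1 - p * s)) * 1 - (1 - p * s) ^ 2) := by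
    have : (1 - p * t) ^ 2 * (1 + t) - (1 - p * s) ^ 2 * (1 + s)
      - (s - t) * (p * ((1 - p * t) + (1 - p * s)) * 1 - (1 - p * s) ^ 2)
      = (s - t) * (p * ((1 - p * t) + (1 - p * s)) * t) := by ring
    rw [this]
    apply mul_nonneg (by linarith)
    apply mul_nonneg (mul_nonneg (by linarith) (by linarith)) ht0
  have h5 : 0 ≤ p * ((1 - p * t) + (1 - p * s)) * 1 - (1 - p * s) ^ 2 := by
    have h6 : 0 ≤ 1 - p * s := by linarith
    nlinarith
  nlinarith [mul_nonneg (sub_nonneg.mpr hts) h5]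

/-- On `|w| ≤ s` the modulus of `(1 - w) (1 + p w)²` is smallest at `-s`. -/
theorem mul_sq_le_norm_mul_sq {p s : ℝ} (hp0 : 4 / 5 ≤ p) (hp1 : p ≤ 5 / 6) (hs : s ≤ 5 / 12)
    {w : ℂ} (hw : ‖w‖ ≤ s) : (1 + s) * (1 - p * s) ^ 2 ≤ ‖1 - w‖ * ‖1 + p * w‖ ^ 2 := by
  set t := ‖w‖ with ht
  have ht0 : 0 ≤ t := norm_nonneg w
  refine (one_add_mul_sq_anti hp0 hp1 ht0 hw hs).trans ?_
  have hx := abs_re_le_of_norm_le (w := w) le_rfl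
  have e : w.re ^ 2 + w.im ^ 2 = t ^ 2 := by
    rw [ht, Complex.sq_norm, Complex.normSq_apply]
    ring
  have h1 : ‖1 - w‖ ^ 2 = (1 + t) ^ 2 - 2 * (t + w.re) := by
    rw [Complex.sq_norm, Complex.normSq_apply]
    simp only [Complex.sub_re, Complex.one_re, Complex.sub_im, Complex.one_im]
    linear_combination e
  have h2 : ‖1 + p * w‖ ^ 2 = (1 - p * t) ^ 2 + 2 * p * (t + w.re) := by
    rw [Complex.sq_norm, Complex.normSq_apply]
    simp only [Complex.add_re, Complex.one_re, Complex.re_ofReal_mul, Complex.add_im,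
      Complex.one_im, Complex.im_ofReal_mul]
    linear_combination p ^ 2 * e
  refine (sq_le_sq₀ (by positivity) (by positivity)).mp ?_
  rw [mul_pow, mul_pow, h1, h2]
  have := one_add_mul_sq_le_aux hp0 hp1 ht0 (hw.trans hs) (by linarith : 0 ≤ t + w.re)
    (by linarith)
  nlinarith

/-- Up to a constant, |ψ'| is the reciprocal square root of |1 - w||1 + pw|³. Both |1 - w||1 + pw|²
and |1 + pw| are smallest at -s, hence |ψ'| is largest there, while |ψ| ≥ Re ψ ≥ m. -/
theorem sharpMajorization_psiRL :
    SharpMajorization psiRL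
      (fun r => (1 - r ^ 2) * (√2 - (√2 - 1) * √((1 + r) / (1 - 2 * (√2 - 1) * r))) - 2 * r) := by
  have h2 : √2 ^ 2 = 2 := Real.sq_sqrt (by norm_num)
  have hlo : 7 / 5 ≤ √2 := Real.le_sqrt_of_sq_le (by norm_num)
  have hhi : √2 ≤ 17 / 12 := Real.sqrt_le_iff.mpr ⟨by norm_num, by norm_num⟩
  obtain ⟨p, hp⟩ : ∃ p : ℝ, p = 2 * (√2 - 1) := ⟨_, rfl⟩
  have hk : √2 - 1 = p / 2 := by linarith
  have hp0 : 4 / 5 ≤ p := by linarith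
  have hp1 : p ≤ 5 / 6 := by linarith
  have hps : ∀ s ∈ Icc (0 : ℝ) 1, 0 < 1 - p * s := fun s hs => by nlinarith [hs.1, hs.2]
  have hu : ∀ s ∈ Icc (0 : ℝ) 1, 0 < (1 + s) / (1 - p * s) := fun s hs =>
    div_pos (by linarith [hs.1]) (hps s hs)
  have hpw : ∀ w : ℂ, ‖w‖ < 1 → 1 + p * w ≠ 0 := fun w hw =>
    ne_zero_of_re_pos (one_add_mul_re_pos (by rw [abs_le]; constructor <;> linarith) hw)
  have hU : ∀ w : ℂ, ‖w‖ < 1 → 0 < ((1 - w) / (1 + p * w)).re := fun w hw => by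
    have hx := abs_re_le_of_norm_le (w := w) le_rfl
    have hW := re_sq_add_im_sq_le (w := w) le_rfl
    rw [Complex.div_re, ← add_div]
    refine div_pos ?_ (Complex.normSq_pos.mpr (hpw w hw))
    simp only [Complex.sub_re, Complex.add_re, Complex.one_re, Complex.re_ofReal_mul,
      Complex.sub_im, Complex.add_im, Complex.one_im, Complex.im_ofReal_mul]
    nlinarith [norm_nonneg w, mul_nonneg (by linarith : 0 ≤ p) (norm_nonneg w)]
  have eψ : psiRL = fun w => (√2 : ℂ) - (p / 2 : ℂ) * ((1 - w) / (1 + p * w)) ^ (1 / 2 : ℂ) := by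
    funext w
    have h1 : ((√2 : ℝ) : ℂ) - 1 = (p / 2 : ℂ) := by
      rw [← Complex.ofReal_one, ← Complex.ofReal_sub, hk]
      push_cast
      rfl
    rw [psiRL, h1]
    congr 4
    ring
  have em : ∀ r : ℝ, √2 - (√2 - 1) * √((1 + r) / (1 - 2 * (√2 - 1) * r))
      = √2 - p / 2 * √((1 + r) / (1 - p * r)) := fun r => by
    rw [hk, mul_div_cancel₀ p two_ne_zero]
  simp only [em]
  rw [eψ]
  have hre : ∀ s ∈ Ico (0 : ℝ) 1, ∀ w : ℂ, ‖w‖ ≤ s → √2 - p / 2 * √((1 + s) / (1 - p * s))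
      ≤ ((√2 : ℂ) - (p / 2 : ℂ) * ((1 - w) / (1 + p * w)) ^ (1 / 2 : ℂ)).re := fun s hs w hw => by
    have e : (p / 2 : ℂ) = ((p / 2 : ℝ) : ℂ) := by push_cast; rfl
    rw [e, Complex.sub_re, Complex.re_ofReal_mul, Complex.ofReal_re]
    have h4 : (((1 - w) / (1 + p * w)) ^ (1 / 2 : ℂ) : ℂ).re ≤ √((1 + s) / (1 - p * s)) := by
      refine (Complex.re_le_norm _).trans ?_
      rw [norm_csqrt, norm_div]
      apply Real.sqrt_le_sqrt
      have h5 : ‖1 - w‖ ≤ 1 + s := by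
        have := norm_sub_le (1 : ℂ) w
        rw [norm_one] at this
        linarith
      have h6 : 1 - p * s ≤ ‖1 + p * w‖ := by
        have := norm_sub_le (1 + p * w) (p * w)
        rw [add_sub_cancel_right, norm_one, norm_mul, Complex.norm_real,
          Real.norm_of_nonneg (by linarith)] at this
        nlinarith
      exact div_le_div₀ (by linarith [hs.1]) h5 (hps s ⟨hs.1, hs.2.le⟩) h6
    have := mul_le_mul_of_nonneg_left h4 (by linarith : 0 ≤ p / 2)
    linarith
  refine sharpMajorization_of_exists ?_ ?_
  · have : (p / 2 : ℂ) = (√2 : ℂ) - 1 := by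
      rw [← Complex.ofReal_one, ← Complex.ofReal_sub, hk]
      push_cast
      rfl
    simp [this]
  refine exists_isSharpRadius_of_norm_logDeriv
    (dψ := fun w => (p / 2 : ℂ) * ((1 + p) / (1 + p * w) ^ 2
      / (2 * ((1 - w) / (1 + p * w)) ^ (1 / 2 : ℂ))))
    (m := fun s => √2 - p / 2 * √((1 + s) / (1 - p * s)))
    (dm := fun s => -(p / 2 * ((1 + p) / (1 - p * s) ^ 2 / (2 * √((1 + s) / (1 - p * s))))))
    (fun w hw => ?_) (fun w hw => ?_) (fun s hs => ?_) ?_ (fun s hs => ?_) (fun s hs => ?_) ?_ ?_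
    (fun s hs w hw => hre s ⟨hs.nonneg, hs.lt_one⟩ w hw) (fun s hs hms w hw => ?_)
    (fun r _ => sub_eq_zero)
  · have h1 : HasDerivAt (fun u : ℂ => (1 - u) / (1 + p * u)) (-((1 + p) / (1 + p * w) ^ 2)) w := by
      refine (((hasDerivAt_id w).const_sub 1).div
        (((hasDerivAt_id w).const_mul (p : ℂ)).const_add 1) (hpw w hw)).congr_deriv ?_
      simp only [id]
      ring
    refine (((hasDerivAt_csqrt h1 (hU w hw)).const_mul (p / 2 : ℂ)).const_sub
      (√2 : ℂ)).congr_deriv ?_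
    ring
  · have h := conj_csqrt (hU w hw)
    simp only [map_div₀, map_sub, map_add, map_one, map_mul, Complex.conj_ofReal] at h
    simp only [map_sub, map_mul, map_div₀, Complex.conj_ofReal, h, map_ofNat]
  · have h := ofReal_csqrt (hu s ⟨hs.1, hs.2.le⟩).le
    push_cast at h
    rw [mul_neg, sub_neg_eq_add, ← sub_eq_add_neg, h]
    push_cast
    ring
  · refine continuousOn_const.sub (continuousOn_const.mul (ContinuousOn.sqrt ?_))
    exact ContinuousOn.div (by fun_prop) (by fun_prop) fun s hs => (hps s hs).ne'
  · have hs' : s ∈ Icc (0 : ℝ) 1 := ⟨hs.1, hs.2.le⟩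
    have h1 : HasDerivAt (fun u : ℝ => (1 + u) / (1 - p * u)) ((1 + p) / (1 - p * s) ^ 2) s := by
      refine (((hasDerivAt_id s).const_add 1).div
        (((hasDerivAt_id s).const_mul p).const_sub 1) (hps s hs').ne').congr_deriv ?_
      simp only [id]
      ring
    exact ((h1.sqrt (hu s hs').ne').const_mul (p / 2)).const_sub √2
  · have := hps s ⟨hs.1.le, hs.2.le⟩
    refine neg_nonpos.mpr ?_
    have : 0 ≤ p := by linarith
    positivity
  · simp
    linarith
  -- From p = 2(√2 - 1) comes p² = 4(1 - p), which makes m(1) exactly 0.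
  · have h1 : √((1 + 1) / (1 - p * 1)) = 2 * √2 / p := by
      rw [Real.sqrt_eq_iff_mul_self_eq (hu 1 (by simp)).le (by positivity)]
      have h3 := (hps 1 (by simp)).ne'
      have h4 : p ^ 2 = 4 * (1 - p * 1) := by
        rw [hp]
        linear_combination 4 * h2
      rw [div_mul_div_comm, ← sq, ← sq, h4, mul_pow, h2, div_eq_div_iff h3 (by positivity)]
      ring
    rw [h1]
    have h4 : p ≠ 0 := by linarith
    field_simp
    norm_num
  · have hs' : s ∈ Ico (0 : ℝ) 1 := ⟨hs.nonneg, hs.lt_one⟩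
    have hw1 := hw.trans_lt hs.lt_one
    refine norm_div_le_neg_div hms (hre s hs' w hw) ?_
    have hnp : ‖(1 + p : ℂ)‖ = 1 + p := by
      rw [← Complex.ofReal_one, ← Complex.ofReal_add, Complex.norm_real,
        Real.norm_of_nonneg (by linarith)]
    have hnp2 : ‖(p / 2 : ℂ)‖ = p / 2 := by
      rw [norm_div, Complex.norm_real, Complex.norm_ofNat, Real.norm_of_nonneg (by linarith)]
    have hP := hps s ⟨hs.nonneg, hs.lt_one.le⟩
    have hsq := hu s ⟨hs.nonneg, hs.lt_one.le⟩
    have hb : 0 < ‖1 + p * w‖ := norm_pos_iff.mpr (hpw w hw1)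
    have key : (1 - p * s) ^ 2 * √((1 + s) / (1 - p * s))
        ≤ ‖1 + p * w‖ ^ 2 * √(‖1 - w‖ / ‖1 + p * w‖) := by
      have h6 : 1 - p * s ≤ ‖1 + p * w‖ := by
        have := norm_sub_le (1 + p * w) (p * w)
        rw [add_sub_cancel_right, norm_one, norm_mul, Complex.norm_real,
          Real.norm_of_nonneg (by linarith)] at this
        nlinarith
      have h7 := mul_sq_le_norm_mul_sq hp0 hp1 hs.lt_five_twelfths.le hw
      refine (sq_le_sq₀ (by positivity) (by positivity)).mp ?_
      rw [mul_pow, mul_pow, Real.sq_sqrt hsq.le, Real.sq_sqrt (by positivity)]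
      have e1 : ((1 - p * s) ^ 2) ^ 2 * ((1 + s) / (1 - p * s))
          = ((1 + s) * (1 - p * s) ^ 2) * (1 - p * s) := by
        field_simp
      have e2 : (‖1 + p * w‖ ^ 2) ^ 2 * (‖1 - w‖ / ‖1 + p * w‖)
          = (‖1 - w‖ * ‖1 + p * w‖ ^ 2) * ‖1 + p * w‖ := by
        field_simp
      rw [e1, e2]
      exact mul_le_mul h7 h6 hP.le (by positivity)
    rw [neg_neg, norm_mul, hnp2, norm_div, norm_div, norm_mul, norm_pow, norm_csqrt, norm_div, hnp,
      Complex.norm_ofNat, div_div, div_div]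
    apply mul_le_mul_of_nonneg_left _ (by linarith)
    have h8 := Real.sqrt_pos.mpr hsq
    apply div_le_div_of_nonneg_left (by linarith) (by positivity)
    linarith

/-! ### Janowski functions and starlikeness of order α -/

theorem janowski_modulus_bounds {D E s R : ℝ} (hE : -1 ≤ E) (hED : E < D) (hD : D ≤ 1)
    (hs0 : 0 ≤ s) (hs1 : s < 1)
    (h : 0 ≤ (1 + D * s - (1 + E * s) * R) * ((1 - E * s) * R - (1 - D * s))) :
    1 - D * s ≤ (1 - E * s) * R ∧ (1 + E * s) * R ≤ 1 + D * s := by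
  have h1 : 0 < 1 - E * s := by nlinarith
  have h2 : 0 < 1 + E * s := by nlinarith
  have h3 : (1 - D * s) * (1 + E * s) ≤ (1 + D * s) * (1 - E * s) := by nlinarith
  by_cases h4 : 1 - D * s ≤ (1 - E * s) * R
  · refine ⟨h4, ?_⟩
    by_contra! h5
    have h6 : (1 - E * s) * R - (1 - D * s) = 0 := by nlinarith
    nlinarith
  · have h4' := not_le.mp h4
    exfalso
    have h5 : 1 + D * s ≤ (1 + E * s) * R := by nlinarith
    nlinarith

/-- This is the coefficient of R - X when the growth estimate is reduced to real values. It is clear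
for E ≥ 0. For E < 0 ≤ D the upper bound on R suffices; for D < 0 both bounds on R enter. -/
theorem janowski_coeff_nonneg {D E s R : ℝ} (hE : -1 ≤ E) (hED : E < D) (hD : D ≤ 1)
    (hs0 : 0 ≤ s) (hs1 : s < 1) (hs2 : 2 * s ≤ 1 - s ^ 2) (hR : 0 < R)
    (hlo : 1 - D * s ≤ (1 - E * s) * R) (hhi : (1 + E * s) * R ≤ 1 + D * s) :
    0 ≤ (1 - s ^ 2) * (E * R ^ 2 + D) + 2 * (1 - s ^ 2 * (D * E)) * R := by
  have hs3 : 0 < 1 - s ^ 2 := by nlinarith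
  have hDE : D * E ≤ 1 := by nlinarith
  have hc : 0 ≤ 1 - s ^ 2 * (D * E) := by nlinarith [sq_nonneg s]
  rcases le_or_gt 0 E with h | h
  · have : 0 ≤ E * R ^ 2 + D := by nlinarith [mul_nonneg h (sq_nonneg R)]
    positivity
  obtain ⟨F, rfl⟩ : ∃ F, E = -F := ⟨-E, (neg_neg E).symm⟩
  have hF0 : 0 < F := by linarith
  have hF1 : F ≤ 1 := by linarith
  have hFs : 0 < 1 - F * s := by nlinarith
  rcases le_or_gt 0 D with hD0 | hD0
  · have h1 : 0 ≤ s * (1 - s ^ 2 - 2 * s + 2 * F * s ^ 2) :=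
      mul_nonneg hs0 (by nlinarith [mul_nonneg hF0.le (sq_nonneg s)])
    have h2 : F * (1 - s ^ 2) * (1 + D * s) ≤ 2 * (1 + s ^ 2 * D * F) * (1 - F * s) := by
      have h3 := mul_nonneg (mul_nonneg hF0.le (sub_nonneg.mpr hD)) h1
      have h4 : F * ((1 - s ^ 2) * (1 + s) + 2 * s - 2 * s ^ 2 * (1 - F * s)) ≤ 2 := by
        have h5 : (1 - s ^ 2) * (1 + s) + 2 * s - 2 * s ^ 2 * (1 - F * s) ≤ 2 := by
          have h6 : 2 - ((1 - s ^ 2) * (1 + s) + 2 * s - 2 * s ^ 2 * (1 - F * s))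
              = (1 - s) ^ 3 + 2 * s ^ 3 * (1 - F) := by ring
          have h7 : 0 ≤ (1 - s) ^ 3 := pow_nonneg (by linarith) 3
          have h8 : 0 ≤ 2 * s ^ 3 * (1 - F) := mul_nonneg (by positivity) (by linarith)
          linarith
        nlinarith
      nlinarith
    have h3 : (1 - F * s) * (F * (1 - s ^ 2) * R) ≤ F * (1 - s ^ 2) * (1 + D * s) := by
      have := mul_le_mul_of_nonneg_left hhi (mul_nonneg hF0.le hs3.le)
      linarith
    have h4 : F * (1 - s ^ 2) * R ≤ 2 * (1 + s ^ 2 * D * F) := by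
      have : (1 - F * s) * (F * (1 - s ^ 2) * R) ≤ (1 - F * s) * (2 * (1 + s ^ 2 * D * F)) := by
        linarith
      exact le_of_mul_le_mul_left this hFs
    have h5 := mul_le_mul_of_nonneg_right h4 hR.le
    have h6 := mul_nonneg hs3.le hD0
    linarith
  · obtain ⟨G, rfl⟩ : ∃ G, D = -G := ⟨-D, (neg_neg D).symm⟩
    have hG0 : 0 < G := by linarith
    have hGs : 0 < 1 + G * s := by positivity
    have h1 : F * R * (1 - s) ≤ 1 - G * s := by
      have h2 : (1 - F * s) * (F * R * (1 - s)) ≤ (1 - F * s) * (1 - G * s) := by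
        have h3 : (1 - F * s) * R ≤ 1 - G * s := by linarith
        have h4 := mul_le_mul_of_nonneg_left h3 (mul_nonneg hF0.le (by linarith : 0 ≤ 1 - s))
        have h5 : 0 ≤ 1 - G * s := by nlinarith
        have h6 : F * (1 - s) ≤ 1 - F * s := by linarith
        have h7 := mul_le_mul_of_nonneg_right h6 h5
        linarith
      exact le_of_mul_le_mul_left h2 hFs
    have h2 : G * (1 + G * s) ≤ R * (G * (1 + s)) := by
      have h3 : 1 + G * s ≤ (1 + F * s) * R := by linarith
      have h4 : (1 + F * s) * R ≤ (1 + s) * R := by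
        apply mul_le_mul_of_nonneg_right _ hR.le
        nlinarith
      have := mul_le_mul_of_nonneg_left (h3.trans h4) hG0.le
      linarith
    have h3 : (1 + s) * (1 - G * s) * (1 + G * s) + G * (1 + s) * (1 - s ^ 2)
        ≤ 2 * (1 - s ^ 2 * G) * (1 + G * s) := by
      have e : 2 * (1 - s ^ 2 * G) * (1 + G * s)
          - ((1 + s) * (1 - G * s) * (1 + G * s) + G * (1 + s) * (1 - s ^ 2))
          = (1 - s) * (1 - G) * (1 - G * s ^ 2) := by ring
      have h4 : 0 ≤ 1 - G * s ^ 2 := by nlinarith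
      have := mul_nonneg (mul_nonneg (by linarith : 0 ≤ 1 - s) (by linarith : 0 ≤ 1 - G)) h4
      linarith
    have h4 : (1 - s ^ 2) * (F * R ^ 2 + G) * (1 + G * s)
        ≤ 2 * (1 - s ^ 2 * (G * F)) * R * (1 + G * s) := by
      have a1 := mul_le_mul_of_nonneg_right h1
        (mul_nonneg (mul_nonneg hR.le (by linarith : 0 ≤ 1 + s)) hGs.le)
      have a2 := mul_le_mul_of_nonneg_right h2 hs3.le
      have a3 := mul_le_mul_of_nonneg_right h3 hR.le
      have a4 : 0 ≤ s ^ 2 * G * (1 - F) * R * (1 + G * s) := by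
        have : 0 ≤ 1 - F := by linarith
        positivity
      linarith
    have := le_of_mul_le_mul_right h4 hGs
    linarith

/-- The radial growth of the modulus `R` of a function subordinate to the Janowski function. -/
theorem janowski_growth {D E s X R : ℝ} (hE : -1 ≤ E) (hED : E < D) (hD : D ≤ 1) (hs0 : 0 ≤ s)
    (hs1 : s < 1) (hs2 : 2 * s ≤ 1 - s ^ 2) (hR : 0 < R) (hX : X ≤ R)
    (hdisc : 0 ≤ s ^ 2 * (D ^ 2 - 2 * D * E * X + E ^ 2 * R ^ 2) - (R ^ 2 - 2 * X + 1)) :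
    1 - D * s ≤ (1 - E * s) * R ∧
    (1 - 4 * s + s ^ 2) / (1 - s ^ 2) * (R - (1 - D * s) / (1 - E * s)) * (D - E)
      ≤ R * ((D + E - E * X - D * X / R ^ 2)
        - (s ^ 2 * (D ^ 2 - 2 * D * E * X + E ^ 2 * R ^ 2) - (R ^ 2 - 2 * X + 1))
          / ((1 - s ^ 2) * R))
        + R * (s * (D - E) ^ 2 / ((1 - D * s) * (1 - E * s))) := by
  have hs3 : 0 < 1 - s ^ 2 := by nlinarith
  have hP : 0 < 1 - D * s := by nlinarith
  have hQ : 0 < 1 - E * s := by nlinarith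
  have hDE : D * E ≤ 1 := by nlinarith
  have hc : 0 ≤ 1 - s ^ 2 * (D * E) := by nlinarith [sq_nonneg s]
  obtain ⟨hlo, hhi⟩ := janowski_modulus_bounds (R := R) hE hED hD hs0 hs1
    (by nlinarith [mul_nonneg hc (sub_nonneg.mpr hX)])
  refine ⟨hlo, ?_⟩
  have hcoef := janowski_coeff_nonneg hE hED hD hs0 hs1 hs2 hR hlo hhi
  -- g/(1 - s²) is the first summand of the right side at X = R. Passing from X to R costs a
  -- nonnegative multiple of R - X, by `hcoef`.
  set g := (1 - s ^ 2) * (R * (D + E) - E * R ^ 2 - D) - s ^ 2 * (D - E * R) ^ 2 + (R - 1) ^ 2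
    with hg
  have h1 : g / (1 - s ^ 2) ≤ R * ((D + E - E * X - D * X / R ^ 2)
      - (s ^ 2 * (D ^ 2 - 2 * D * E * X + E ^ 2 * R ^ 2) - (R ^ 2 - 2 * X + 1))
        / ((1 - s ^ 2) * R)) := by
    have e : R * ((D + E - E * X - D * X / R ^ 2)
      - (s ^ 2 * (D ^ 2 - 2 * D * E * X + E ^ 2 * R ^ 2) - (R ^ 2 - 2 * X + 1))
        / ((1 - s ^ 2) * R)) - g / (1 - s ^ 2)
        = (R - X) * ((1 - s ^ 2) * (E * R ^ 2 + D) + 2 * (1 - s ^ 2 * (D * E)) * R)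
          / ((1 - s ^ 2) * R) := by
      rw [hg]
      have := hs3.ne'
      field_simp
      ring
    have : 0 ≤ (R - X) * ((1 - s ^ 2) * (E * R ^ 2 + D) + 2 * (1 - s ^ 2 * (D * E)) * R)
          / ((1 - s ^ 2) * R) :=
      div_nonneg (mul_nonneg (sub_nonneg.mpr hX) hcoef) (by positivity)
    linarith
  have h2 : 0 ≤ g * ((1 - D * s) * (1 - E * s)) + R * s * (1 - s ^ 2) * (D - E) ^ 2
      - (1 - 4 * s + s ^ 2) * (D - E) * (1 - D * s) * ((1 - E * s) * R - (1 - D * s)) := by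
    -- At R = (1 - Ds)/(1 - Es) the inequality is an equality, so that factor splits off. The
    -- cofactor is nondecreasing in R, so `h3` reduces to this least value of R.
    have e : g * ((1 - D * s) * (1 - E * s)) + R * s * (1 - s ^ 2) * (D - E) ^ 2
        = ((1 - E * s) * R - (1 - D * s)) * ((1 - E) * (1 + s ^ 2 * E) * (1 - D * s) * R
          - (1 - D) * (1 + s ^ 2 * D) * (1 - E * s)) := by
      rw [hg]
      ring
    rw [e]
    have h3 : 0 ≤ (1 - E) * (1 + s ^ 2 * E) * (1 - D * s) * R
          - (1 - D) * (1 + s ^ 2 * D) * (1 - E * s) - (1 - 4 * s + s ^ 2) * (D - E) * (1 - D * s) := by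
      have ha : 0 ≤ (1 - E) * (1 + s ^ 2 * E) * (1 - D * s) :=
        mul_nonneg (mul_nonneg (by linarith) (by nlinarith)) hP.le
      have h4 := mul_le_mul_of_nonneg_left hlo ha
      have e2 : (1 - E) * (1 + s ^ 2 * E) * (1 - D * s) * (1 - D * s)
          - (1 - D) * (1 + s ^ 2 * D) * (1 - E * s) ^ 2
          - (1 - 4 * s + s ^ 2) * (D - E) * (1 - D * s) * (1 - E * s)
          = (D - E) * ((1 - s) * ((1 + s) * ((1 - D * s) + (1 - E * s))
            - 2 * ((1 - D * s) * (1 - E * s)))) := by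
        ring
      have h5 : 0 ≤ (1 + s) * ((1 - D * s) + (1 - E * s)) - 2 * ((1 - D * s) * (1 - E * s)) := by
        have h6 : 1 - E * s ≤ 1 + s := by nlinarith
        have h7 : 1 - D * s ≤ 1 + s := by nlinarith
        nlinarith [mul_nonneg hP.le (sub_nonneg.mpr h6), mul_nonneg hQ.le (sub_nonneg.mpr h7)]
      have h6 : 0 ≤ (D - E) * ((1 - s) * ((1 + s) * ((1 - D * s) + (1 - E * s))
            - 2 * ((1 - D * s) * (1 - E * s)))) :=
        mul_nonneg (by linarith) (mul_nonneg (by linarith) h5)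
      refine le_of_mul_le_mul_left ?_ hQ
      linarith
    have := mul_nonneg (sub_nonneg.mpr hlo) h3
    linarith
  have h3 : (1 - 4 * s + s ^ 2) / (1 - s ^ 2) * (R - (1 - D * s) / (1 - E * s)) * (D - E)
      ≤ g / (1 - s ^ 2) + R * (s * (D - E) ^ 2 / ((1 - D * s) * (1 - E * s))) := by
    rw [← sub_nonneg]
    have e : ∀ T P Q K : ℝ, T ≠ 0 → P ≠ 0 → Q ≠ 0 →
        g / T + R * (s * (D - E) ^ 2 / (P * Q)) - K / T * (R - P / Q) * (D - E)
        = (g * (P * Q) + R * s * T * (D - E) ^ 2 - K * (D - E) * P * (Q * R - P))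
          / (T * (P * Q)) := by
      intro T P Q K hT hP hQ
      field_simp
    rw [e _ _ _ _ hs3.ne' hP.ne' hQ.ne']
    positivity
  linarith

/-- The radial growth of `|ψ ∘ ω|` for the Janowski function, in terms of the pointwise data. -/
theorem janowski_growth_complex {D E s : ℝ} (hE : -1 ≤ E) (hED : E < D) (hD : D ≤ 1)
    (hs0 : 0 ≤ s) (hs1 : s < 1) (hs2 : 2 * s ≤ 1 - s ^ 2) {w ζ : ℂ} (hw : ‖w‖ ≤ s)
    (hζ : ‖ζ‖ ≤ (s ^ 2 - ‖w‖ ^ 2) / (1 - s ^ 2)) :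
    (1 - D * s) / (1 - E * s) ≤ ‖psiJanowski D E w‖ ∧
    (1 - 4 * s + s ^ 2) / (1 - s ^ 2) * (‖psiJanowski D E w‖ - (1 - D * s) / (1 - E * s))
      ≤ ‖psiJanowski D E w‖ * (((w + ζ) * (((D : ℂ) - E) / (1 + E * w) ^ 2 / psiJanowski D E w)).re
        + s * (D - E) / ((1 - D * s) * (1 - E * s))) := by
  have hw1 := hw.trans_lt hs1
  have hδ : 0 < D - E := sub_pos.mpr hED
  have hQ : 0 < 1 - E * s := by nlinarith
  have hs3 : 0 < 1 - s ^ 2 := by nlinarith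
  have hEw : 1 + (E : ℂ) * w ≠ 0 :=
    ne_zero_of_re_pos (one_add_mul_re_pos (abs_le.mpr ⟨hE, by linarith⟩) hw1)
  have hDw : 1 + (D : ℂ) * w ≠ 0 :=
    ne_zero_of_re_pos (one_add_mul_re_pos (abs_le.mpr ⟨by linarith, hD⟩) hw1)
  have hδc : (D : ℂ) - E ≠ 0 := by
    rw [← Complex.ofReal_sub]
    exact_mod_cast hδ.ne'
  set v := psiJanowski D E w with hv
  have hvdef : v = (1 + D * w) / (1 + E * w) := rfl
  have hv0 : v ≠ 0 := div_ne_zero hDw hEw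
  have hR : 0 < ‖v‖ := norm_pos_iff.mpr hv0
  have hj : (D : ℂ) - E * v = (D - E) / (1 + E * w) := by
    rw [hvdef]
    field_simp
    ring
  have hR2 : v.re ^ 2 + v.im ^ 2 = ‖v‖ ^ 2 := by
    rw [Complex.sq_norm, Complex.normSq_apply]
    ring
  have hn1 : ‖(D : ℂ) - E * v‖ ^ 2 = D ^ 2 - 2 * D * E * v.re + E ^ 2 * ‖v‖ ^ 2 := by
    rw [Complex.sq_norm, Complex.normSq_apply]
    simp only [Complex.sub_re, Complex.ofReal_re, Complex.re_ofReal_mul, Complex.sub_im,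
      Complex.ofReal_im, Complex.im_ofReal_mul]
    linear_combination E ^ 2 * hR2
  -- Solving for w expresses |w|, |ψ'/ψ| and Re(wψ'/ψ) through v = ψ(w) alone, leaving only the real
  -- variables Re v and |v|.
  have hwv : w * ((D : ℂ) - E * v) = v - 1 := by
    rw [hj, hvdef, div_sub_one hEw, mul_div_assoc']
    congr 1
    ring
  have hn2 : ‖w‖ ^ 2 * ‖(D : ℂ) - E * v‖ ^ 2 = ‖v‖ ^ 2 - 2 * v.re + 1 := by
    rw [← mul_pow, ← norm_mul, hwv, Complex.sq_norm, Complex.normSq_apply]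
    simp only [Complex.sub_re, Complex.one_re, Complex.sub_im, Complex.one_im]
    linear_combination hR2
  have hww : ‖w‖ ^ 2 ≤ s ^ 2 := by gcongr
  obtain ⟨hlo, hgr⟩ := janowski_growth (X := v.re) (R := ‖v‖) hE hED hD hs0 hs1 hs2 hR
    (Complex.re_le_norm v) (by
      rw [← hn1, ← hn2]
      nlinarith [mul_nonneg (sub_nonneg.mpr hww) (sq_nonneg ‖(D : ℂ) - E * v‖)])
  refine ⟨(div_le_iff₀' hQ).mpr hlo, ?_⟩
  have e1 : ((D : ℂ) - E) / (1 + E * w) ^ 2 / v = ((D : ℂ) - E * v) ^ 2 / ((D - E) * v) := by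
    rw [hj]
    field_simp
  have e2 : w * (((D : ℂ) - E) / (1 + E * w) ^ 2 / v) * ((D - E : ℝ) : ℂ)
      = ((D + E : ℝ) : ℂ) - E * v - D * v⁻¹ := by
    have h1 : w * (((D : ℂ) - E * v) ^ 2 / ((D - E) * v)) * (D - E)
        = w * (D - E * v) * (D - E * v) / v := by
      field_simp
    rw [e1]
    push_cast
    rw [h1, hwv]
    field_simp
    ring
  have hre : (D - E) * (w * (((D : ℂ) - E) / (1 + E * w) ^ 2 / v)).re
      = D + E - E * v.re - D * v.re / ‖v‖ ^ 2 := by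
    have h := congrArg Complex.re e2
    rw [Complex.re_mul_ofReal, Complex.sub_re, Complex.sub_re, Complex.ofReal_re,
      Complex.re_ofReal_mul, Complex.re_ofReal_mul, Complex.inv_re,
      Complex.normSq_eq_norm_sq] at h
    rw [mul_comm, h]
    ring
  have hnorm : (D - E) * ‖ζ * (((D : ℂ) - E) / (1 + E * w) ^ 2 / v)‖
      ≤ (s ^ 2 * (D ^ 2 - 2 * D * E * v.re + E ^ 2 * ‖v‖ ^ 2) - (‖v‖ ^ 2 - 2 * v.re + 1))
        / ((1 - s ^ 2) * ‖v‖) := by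
    have h1 : ‖(D : ℂ) - E‖ = D - E := by
      rw [← Complex.ofReal_sub, Complex.norm_real, Real.norm_of_nonneg hδ.le]
    rw [e1, norm_mul, norm_div, norm_pow, norm_mul, h1, ← hn2, ← hn1]
    have h2 : (D - E) * (‖ζ‖ * (‖(D : ℂ) - E * v‖ ^ 2 / ((D - E) * ‖v‖)))
        = ‖ζ‖ * (‖(D : ℂ) - E * v‖ ^ 2 / ‖v‖) := by
      field_simp
    have h3 : (s ^ 2 * ‖(D : ℂ) - E * v‖ ^ 2 - ‖w‖ ^ 2 * ‖(D : ℂ) - E * v‖ ^ 2)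
        / ((1 - s ^ 2) * ‖v‖)
        = (s ^ 2 - ‖w‖ ^ 2) / (1 - s ^ 2) * (‖(D : ℂ) - E * v‖ ^ 2 / ‖v‖) := by
      have := hs3.ne'
      field_simp
    rw [h2, h3]
    gcongr
  have hζre := (abs_le.mp (Complex.abs_re_le_norm
    (ζ * (((D : ℂ) - E) / (1 + E * w) ^ 2 / v)))).1
  have hζre' := mul_le_mul_of_nonneg_left hζre hδ.le
  rw [add_mul, Complex.add_re]
  refine le_of_mul_le_mul_right (hgr.trans ?_) hδ
  rw [← hre]
  set A := (w * (((D : ℂ) - E) / (1 + E * w) ^ 2 / v)).re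
  set C := (ζ * (((D : ℂ) - E) / (1 + E * w) ^ 2 / v)).re
  set B := (s ^ 2 * (D ^ 2 - 2 * D * E * v.re + E ^ 2 * ‖v‖ ^ 2) - (‖v‖ ^ 2 - 2 * v.re + 1))
        / ((1 - s ^ 2) * ‖v‖)
  have h1 : (D - E) * A - B ≤ (D - E) * A + (D - E) * C := by linarith
  have h2 := mul_le_mul_of_nonneg_left h1 hR.le
  have e3 : s * (D - E) ^ 2 / ((1 - D * s) * (1 - E * s))
      = (s * (D - E) / ((1 - D * s) * (1 - E * s))) * (D - E) := by ring
  rw [e3]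
  linarith

/-- The growth bound has coefficient K = (1 - 4s + s²)/(1 - s²), which is negative for s > 2 - √3 <
√2 - 1; with it, β ≡ 1 is not enough. What is needed is m(1 - β) ≤ sβ' + βK, and since m ≤ 1 the
version without m suffices. -/
theorem sharpMajorization_psiJanowski {D E : ℝ} {q : ℝ → ℝ} (hE : -1 ≤ E) (hED : E < D)
    (hD : D ≤ 1)
    (hq : ∀ r ∈ Ioo (0 : ℝ) 1, q r = 0 ↔ (1 - r ^ 2) * ((1 - D * r) / (1 - E * r)) = 2 * r) :
    SharpMajorization (psiJanowski D E) q := by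
  have hE' : |E| ≤ 1 := abs_le.mpr ⟨hE, by linarith⟩
  have hQ : ∀ s ∈ Icc (0 : ℝ) 1, 0 < 1 - E * s := fun s hs => by nlinarith [hs.1, hs.2]
  have hδ : 0 < D - E := sub_pos.mpr hED
  have hEw : ∀ w : ℂ, ‖w‖ < 1 → 1 + (E : ℂ) * w ≠ 0 := fun w hw =>
    ne_zero_of_re_pos (one_add_mul_re_pos hE' hw)
  refine sharpMajorization_of_exists (by simp [psiJanowski]) ?_
  refine exists_isSharpRadius (dψ := fun w => ((D : ℂ) - E) / (1 + E * w) ^ 2)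
    (m := fun s => (1 - D * s) / (1 - E * s)) (dm := fun s => -((D - E) / (1 - E * s) ^ 2))
    (β := fun s => 1 / 2 + 2 / 3 * s + 6 / 5 * s ^ 2) (dβ := fun s => 2 / 3 + 12 / 5 * s)
    (fun w hw => ?_) (fun w _ => by simp [psiJanowski])
    (fun s _ => by simp [psiJanowski, sub_eq_add_neg])
    (ContinuousOn.div (by fun_prop) (by fun_prop) fun s hs => (hQ s hs).ne') (fun s hs => ?_)
    (fun s _ => neg_nonpos.mpr (div_nonneg hδ.le (sq_nonneg _))) (by simp) ?_
    (fun s hs w hw => le_re_janowski hE' hED.le hs.nonneg hs.lt_one hw) (fun s => ?_)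
    (fun s hs => ?_) (fun s hs hms w ζ hw hζ => ?_) hq
  · refine ((((hasDerivAt_id w).const_mul (D : ℂ)).const_add 1).div
      (((hasDerivAt_id w).const_mul (E : ℂ)).const_add 1) (hEw w hw)).congr_deriv ?_
    simp only [id]
    ring
  · refine ((((hasDerivAt_id s).const_mul D).const_sub 1).div
      (((hasDerivAt_id s).const_mul E).const_sub 1) (hQ s ⟨hs.1, hs.2.le⟩).ne').congr_deriv ?_
    simp only [id]
    ring
  · exact div_nonneg (by linarith) (hQ 1 (right_mem_Icc.mpr zero_le_one)).le
  · refine ((((hasDerivAt_id s).const_mul (2 / 3)).const_add (1 / 2)).add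
      ((hasDerivAt_pow 2 s).const_mul (6 / 5))).congr_deriv ?_
    simp only [Nat.cast_ofNat, Nat.add_one_sub_one, pow_one]
    ring
  · have h0 := hs.nonneg
    have h5 := hs.lt_five_twelfths
    constructor
    · positivity
    · nlinarith
  · obtain ⟨hmR, hgr⟩ := janowski_growth_complex hE hED hD hs.nonneg hs.lt_one hs.le_sub hw hζ
    have h0 := hs.nonneg
    have h1 := hs.lt_one
    have h5 := hs.lt_five_twelfths
    have hs3 : 0 < 1 - s ^ 2 := by nlinarith
    have hQs := hQ s ⟨h0, h1.le⟩
    have hP : 0 < 1 - D * s := by nlinarith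
    have hm1 : (1 - D * s) / (1 - E * s) ≤ 1 := (div_le_one hQs).mpr (by nlinarith)
    have e1 : s * -((D - E) / (1 - E * s) ^ 2) / ((1 - D * s) / (1 - E * s))
        = -(s * (D - E) / ((1 - D * s) * (1 - E * s))) := by
      have := hP.ne'
      have := hQs.ne'
      field_simp
    simp only [e1, sub_neg_eq_add]
    set R := ‖psiJanowski D E w‖
    set m := (1 - D * s) / (1 - E * s)
    set N := ((w + ζ) * (((D : ℂ) - E) / (1 + E * w) ^ 2 / psiJanowski D E w)).re
      + s * (D - E) / ((1 - D * s) * (1 - E * s))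
    set K := (1 - 4 * s + s ^ 2) / (1 - s ^ 2) with hK
    -- The coefficients 1/2 and 2/3 cancel the terms of order 0 and 1 in sβ' + βK - (1 - β). The
    -- coefficient 6/5 makes the remainder nonnegative up to 5/12 and still keeps β ≤ 1 there.
    set b := 1 / 2 + 2 / 3 * s + 6 / 5 * s ^ 2 with hb
    have hb0 : 0 ≤ b := by positivity
    have hb1 : b ≤ 1 := by nlinarith
    have hweight : 1 - b ≤ s * (2 / 3 + 12 / 5 * s) + b * K := by
      rw [← sub_nonneg]
      have e : s * (2 / 3 + 12 / 5 * s) + b * K - (1 - b)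
          = s ^ 2 * (47 / 15 - 82 / 15 * s - 12 / 5 * s ^ 2) / (1 - s ^ 2) := by
        rw [hK, hb]
        have := hs3.ne'
        field_simp
        ring
      rw [e]
      apply div_nonneg (mul_nonneg (sq_nonneg s) (by nlinarith)) hs3.le
    have hmb : m * (1 - b) ≤ s * (2 / 3 + 12 / 5 * s) + b * K :=
      (mul_le_of_le_one_left (by linarith) hm1).trans hweight
    obtain ⟨e, he, he0⟩ : ∃ e, R = m * (1 + e) ∧ 0 ≤ e :=
      ⟨R / m - 1, by field_simp; ring, sub_nonneg.mpr ((one_le_div hms).mpr hmR)⟩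
    have hRm : R / m = 1 + e := by
      rw [he]
      field_simp
    have hgr' : K * e ≤ (1 + e) * N := by
      rw [he] at hgr
      refine le_of_mul_le_mul_left ?_ hms
      linarith
    rw [hRm, he]
    have h6 := mul_le_mul_of_nonneg_left hgr' hb0
    have h7 := mul_le_mul_of_nonneg_right hmb he0
    linarith

/-- This is the Janowski case D = 1 - 2α, E = -1, where the factor 1 + r cancels from the equation
for the radius. -/
theorem sharpMajorization_psiOrder {α : ℝ} (hα0 : 0 ≤ α) (hα1 : α < 1) :
    SharpMajorization (psiOrder α) (fun r => (1 - r) * (1 - (1 - 2 * α) * r) - 2 * r) := by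
  have e : psiOrder α = psiJanowski (1 - 2 * α) (-1) := by
    funext z
    simp [psiOrder, psiJanowski, sub_eq_add_neg]
  rw [e]
  refine sharpMajorization_psiJanowski le_rfl (by linarith) (by linarith) fun r hr => ?_
  have h1 : 1 + r ≠ 0 := by linarith [hr.1]
  have h2 : (1 - r ^ 2) * ((1 - (1 - 2 * α) * r) / (1 - (-1) * r))
      = (1 - r) * (1 - (1 - 2 * α) * r) := by
    rw [show 1 - (-1) * r = 1 + r by ring, ← mul_div_assoc, div_eq_iff h1]
    ring
  rw [h2, sub_eq_zero]

end ConjStarlike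

theorem corollary2p3 :
    -- (i)
    (∀ D E : ℝ, -1 ≤ E → E < D → D ≤ 1 →
      ConjStarlike.SharpMajorization (ConjStarlike.psiJanowski D E)
        (fun r => (1 - r ^ 2) * ((1 - D * r) / (1 - E * r)) - 2 * r)) ∧
    -- (ii)
    (∀ α : ℝ, 0 ≤ α → α < 1 →
      ConjStarlike.SharpMajorization (ConjStarlike.psiOrder α)
        (fun r => (1 - r) * (1 - (1 - 2 * α) * r) - 2 * r)) ∧
    -- (iii)
    (∀ η : ℝ, 0 < η → η ≤ 1 →
      ConjStarlike.SharpMajorization (ConjStarlike.psiStrong η)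
        (fun r => (1 - r ^ 2) * ((1 - r) / (1 + r)) ^ η - 2 * r)) ∧
    -- (iv)
    ConjStarlike.SharpMajorization ConjStarlike.psiRL
      (fun r => (1 - r ^ 2) * (√2 - (√2 - 1) * √((1 + r) / (1 - 2 * (√2 - 1) * r))) - 2 * r) ∧
    -- (v): the sharpness clause carries the normalization `ψ(0) = 1`
    (∀ a b : ℝ, 1 ≤ a → 1 / 2 ≤ b →
      ∃ ρ : ℝ,
        ConjStarlike.IsSmallestRoot
          (fun r => (1 - r ^ 2) * (b * (1 - r)) ^ (1 / a) - 2 * r) ρ ∧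
        ConjStarlike.MajorizesDerivUpTo
          (ConjStarlike.starlikeConj (ConjStarlike.psiPower a b)) ρ ∧
        (ConjStarlike.psiPower a b 0 = 1 →
          ConjStarlike.IsSharpRadius
            (ConjStarlike.starlikeConj (ConjStarlike.psiPower a b)) ρ)) ∧
    -- (vi)
    ConjStarlike.SharpMajorization Complex.exp
      (fun r => (1 - r ^ 2) - 2 * r * Real.exp r) ∧
    -- (vii)
    ConjStarlike.SharpMajorization ConjStarlike.psiCrescent
      (fun r => (1 - r ^ 2) * (√(1 + r ^ 2) - r) - 2 * r) ∧
    -- (viii)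
    ConjStarlike.SharpMajorization ConjStarlike.psiSigmoid
      (fun r => (1 - r ^ 2) - r * (1 + Real.exp r)) ∧
    -- (ix)
    ConjStarlike.SharpMajorization (fun z => 1 + Complex.sin z)
      (fun r => (1 - r ^ 2) * (1 - Real.sin r) - 2 * r) :=
  ⟨fun _ _ hE hED hD => ConjStarlike.sharpMajorization_psiJanowski hE hED hD
      fun _ _ => sub_eq_zero,
    fun _ h0 h1 => ConjStarlike.sharpMajorization_psiOrder h0 h1,
    fun _ h0 h1 => ConjStarlike.sharpMajorization_psiStrong h0 h1,
    ConjStarlike.sharpMajorization_psiRL,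
    fun _ _ ha hb => ConjStarlike.exists_isSharpRadius_psiPower ha (by linarith),
    ConjStarlike.sharpMajorization_exp, ConjStarlike.sharpMajorization_psiCrescent,
    ConjStarlike.sharpMajorization_psiSigmoid, ConjStarlike.sharpMajorization_one_add_sin⟩
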